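/- Equip $\mathfrak{su}(2)$ with the invariant inner product $\langle x,y\rangle=-2\operatorname{tr}(xy)$, so that $\mathfrak{su}(2)\cong(\mathbb R^3,\times,\cdot)$, and put $\Phi(a_1,a_2,a_3)=\langle a_1,[a_2,a_3]\rangle$ on $\mathfrak{su}(2)^3$. For real numbers $q,r\ge 0$ let $$N_{q,r}=\{(a_1,a_2,a_3)\in\mathfrak{su}(2)^3:\ \Phi(a_1,a_2,a_3)<0,\ \langle a_i,a_j\rangle=0\ (i\ne j),\ \langle a_1,a_1\rangle-\langle a_2,a_2\rangle=q,\ \langle a_2,a_2\rangle-\langle a_3,a_3\rangle=r\},$$ a 4-dimensional embedded submanifold of $\mathfrak{su}(2)^3$ with the global frame $$V_0=([a_2,a_3],[a_3,a_1],[a_1,a_2]),\quad V_1=(0,[a_2,a_1],[a_3,a_1]),\quad V_2=([a_1,a_2],0,[a_3,a_2]),\quad V_3=([a_1,a_3],[a_2,a_3],0)$$ and the hyperkähler structure $(g,I,J,K)$ given by $g(V_i,V_j)=-\delta_{ij}\Phi$ and $$I(V_0,V_1,V_2,V_3)=(V_1,-V_0,V_3,-V_2),\quad J(V_0,V_1,V_2,V_3)=(V_2,-V_3,-V_0,V_1),\quad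 K(V_0,V_1,V_2,V_3)=(V_3,V_2,-V_1,-V_0).$$ Let $\overline N_{q,r}$ be the closure of $N_{q,r}$ in $\mathfrak{su}(2)^3$, and let $\kappa_{q,r}$ be the sectional curvature of $g$. We say that the hyperkähler structure of $N_{q,r}$ extends to a point $p\in\overline N_{q,r}$ if some open neighbourhood $U$ of $p$ in $\overline N_{q,r}$ has a homeomorphism $\psi:S\to U$ from a subset $S\subset\mathbb R^4$ such that $\psi$ restricts to a smooth local parametrization of $N_{q,r}$ over $U\cap N_{q,r}$, and there is a hyperkähler structure on $S$ (with tensors smooth in a neighbourhood of each point of $S$) that agrees over $U\cap N_{q,r}$ with the one of $N_{q,r}$. Suppose that $N_{q,r}$ is of type 2, i.e. $q\ge 0$ and $r>0$. Then for every $p\in\overline N_{q,r}\setminus N_{q,r}$ the sectional curvature $\kappa_{q,r}(V_0,V_1)|_{\eta}$ tends to $+\infty$ as $\eta\in N_{q,r}$ tends to $p$, and the hyperkähler structure of $N_{q,r}$ does not extend to $p$. Moreover, $N_{q,r}$ is diffeomorphic to the nilpotent orbit $\{x\in\mathfrak{sl}(2,\mathbb C): x\ne 0,\ \operatorname{ad}(x)\text{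 nilpotent}\}$ of $\mathfrak{sl}(2,\mathbb C)$. -/

import Mathlib

open Set Filter Topology
open scoped ContDiff

namespace HyperLie

noncomputable section

/-! ### The Lie algebra `su(2)` -/

/-- The Lie algebra `su(2)`, in coordinates with respect to the basis
`e₁ = ½ [[0, i], [i, 0]]`, `e₂ = ½ [[0, -1], [1, 0]]`, `e₃ = ½ [[i, 0], [0, -i]]`. -/
abbrev Su2 : Type := Fin 3 → ℝ

/-- The Lie bracket of `su(2)`: since `[e₁, e₂] = e₃` and cyclically, it is the cross product. -/
def br (x y : Su2) : Su2 := crossProduct x y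

/-- The invariant inner product of `su(2)` (the negative multiple of the Killing form)
for which `e₁, e₂, e₃` is orthonormal. -/
def ip (x y : Su2) : ℝ := x ⬝ᵥ y

/-- The matrix `x₁ e₁ + x₂ e₂ + x₃ e₃`. -/
def toMat (x : Su2) : Matrix (Fin 2) (Fin 2) ℂ :=
  !![Complex.I * (x 2 : ℂ) / 2, (Complex.I * (x 0 : ℂ) - (x 1 : ℂ)) / 2;
    (Complex.I * (x 0 : ℂ) + (x 1 : ℂ)) / 2, -(Complex.I * (x 2 : ℂ)) / 2]

/-- `toMat` turns the bracket into the commutator of matrices. -/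
theorem toMat_br (x y : Su2) : toMat (br x y) = toMat x * toMat y - toMat y * toMat x := by
  ext i j
  fin_cases i <;> fin_cases j <;>
    simp [toMat, br, cross_apply] <;>
    ring_nf <;> simp only [Complex.I_sq] <;> ring

/-- The inner product is `-2 tr(x y)`, i.e. `-1/2` times the Killing form of `su(2)`. -/
theorem ip_eq_trace (x y : Su2) : ((ip x y : ℝ) : ℂ) = -2 * (toMat x * toMat y).trace := by
  simp [toMat, ip, Matrix.trace, dotProduct, Fin.sum_univ_two,
    Fin.sum_univ_three]
  ring_nf
  simp only [Complex.I_sq]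
  ring

/-- The image of `toMat` is the space of traceless skew-Hermitian matrices. -/
theorem range_toMat : range toMat = {m | m.conjTranspose = -m ∧ m.trace = 0} := by
  ext m
  constructor
  · rintro ⟨x, rfl⟩
    refine ⟨?_, ?_⟩
    · ext i j
      fin_cases i <;> fin_cases j <;>
        simp [toMat, Matrix.conjTranspose_apply] <;> ring
    · simp [toMat, Matrix.trace, Fin.sum_univ_two]
      ring
  · rintro ⟨h, ht⟩
    refine ⟨![2 * (m 0 1).im, -2 * (m 0 1).re, 2 * (m 0 0).im], ?_⟩
    have h00 := congrFun (congrFun h 0) 0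
    have h10 := congrFun (congrFun h 1) 0
    have ht' : m 0 0 + m 1 1 = 0 := by simpa [Matrix.trace, Fin.sum_univ_two] using ht
    simp [Matrix.conjTranspose_apply, Complex.ext_iff] at h00 h10
    simp [Complex.ext_iff] at ht'
    ext i j
    fin_cases i <;> fin_cases j <;> simp [toMat, Complex.ext_iff]
    · linarith
    · constructor
      · linarith [h10.1]
      · linarith [h10.2]
    · constructor
      · linarith [ht'.1]
      · linarith [ht'.2]

/-! ### The leaves `N_{q,r}` and their hyperkähler structure -/

/-- The space `su(2)³` of triples `(a₁, a₂, a₃) = (a 0, a 1, a 2)`. -/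
abbrev Triple : Type := Fin 3 → Su2

/-- `Φ(a₁, a₂, a₃) = ⟨a₁, [a₂, a₃]⟩`. -/
def Phi (a : Triple) : ℝ := ip (a 0) (br (a 1) (a 2))

/-- The leaf `N_{q,r}`. It is of type 2 when `0 ≤ q` and `0 < r`. -/
def leaf (q r : ℝ) : Set Triple :=
  {a | Phi a < 0 ∧ (∀ i j, i ≠ j → ip (a i) (a j) = 0) ∧
    ip (a 0) (a 0) - ip (a 1) (a 1) = q ∧ ip (a 1) (a 1) - ip (a 2) (a 2) = r}

/-- The global frame `V₀, V₁, V₂, V₃` of the leaves. -/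
def frame (a : Triple) : Fin 4 → Triple :=
  ![![br (a 1) (a 2), br (a 2) (a 0), br (a 0) (a 1)],
    ![0, br (a 1) (a 0), br (a 2) (a 0)],
    ![br (a 0) (a 1), 0, br (a 2) (a 1)],
    ![br (a 0) (a 2), br (a 1) (a 2), 0]]

/-- The product inner product on `su(2)³`. -/
def ip3 (v w : Triple) : ℝ := ∑ k, ip (v k) (w k)

theorem ip3_add_left (v v' w : Triple) : ip3 (v + v') w = ip3 v w + ip3 v' w := by
  simp [ip3, ip, add_dotProduct, Finset.sum_add_distrib]

theorem ip3_smul_left (c : ℝ) (v w : Triple) : ip3 (c • v) w = c * ip3 v w := by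
  simp [ip3, ip, smul_dotProduct, Finset.mul_sum]

/-- The coefficient of `V_i` of a tangent vector of a leaf `N_{q,r}` at `a`. (At the points of
`N_{q,r}` the frame is orthogonal for `ip3`; see `frameCoord_frame`.) -/
def frameCoord (a : Triple) (i : Fin 4) : Triple →L[ℝ] ℝ :=
  LinearMap.toContinuousLinearMap
    { toFun := fun w => ip3 w (frame a i) / ip3 (frame a i) (frame a i)
      map_add' := fun v w => by rw [ip3_add_left, add_div]
      map_smul' := fun c v => by rw [ip3_smul_left, mul_div_assoc]; rfl }

/-- The metric of the leaves: `g(V_i, V_j) = - δ_{ij} Φ`. -/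
def leafMetric (a : Triple) : Triple →L[ℝ] Triple →L[ℝ] ℝ :=
  (-Phi a) • ∑ i, (frameCoord a i).smulRight (frameCoord a i)

/-- `I(V₀, V₁, V₂, V₃) = (V₁, -V₀, V₃, -V₂)`. -/
def leafI (a : Triple) : Triple →L[ℝ] Triple :=
  ∑ i, (frameCoord a i).smulRight (![frame a 1, -frame a 0, frame a 3, -frame a 2] i)

/-- `J(V₀, V₁, V₂, V₃) = (V₂, -V₃, -V₀, V₁)`. -/
def leafJ (a : Triple) : Triple →L[ℝ] Triple :=
  ∑ i, (frameCoord a i).smulRight (![frame a 2, -frame a 3, -frame a 0, frame a 1] i)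

/-- `K(V₀, V₁, V₂, V₃) = (V₃, V₂, -V₁, -V₀)`. -/
def leafK (a : Triple) : Triple →L[ℝ] Triple :=
  ∑ i, (frameCoord a i).smulRight (![frame a 3, frame a 2, -frame a 1, -frame a 0] i)

theorem frameCoord_frame {q r : ℝ} {a : Triple} (ha : a ∈ leaf q r) (i j : Fin 4) :
    frameCoord a i (frame a j) = if i = j then 1 else 0 := by
  obtain ⟨hP, ho, -, -⟩ := ha
  have h01 : ip (a 0) (a 1) = 0 := ho 0 1 (by decide)
  have h02 : ip (a 0) (a 2) = 0 := ho 0 2 (by decide)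
  have h12 : ip (a 1) (a 2) = 0 := ho 1 2 (by decide)
  have h10 : ip (a 1) (a 0) = 0 := ho 1 0 (by decide)
  have h20 : ip (a 2) (a 0) = 0 := ho 2 0 (by decide)
  have h21 : ip (a 2) (a 1) = 0 := ho 2 1 (by decide)
  have hpos : ∀ k, a k ≠ 0 → 0 < ip (a k) (a k) := by
    intro k hk
    have h1 : 0 ≤ ip (a k) (a k) := by
      simp only [ip, dotProduct]
      exact Finset.sum_nonneg fun i _ => mul_self_nonneg _
    refine lt_of_le_of_ne h1 fun h => hk ?_
    exact dotProduct_self_eq_zero.1 h.symm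
  have h0 := hpos 0 (fun h => by simp [Phi, ip, h] at hP)
  have h1 := hpos 1 (fun h => by simp [Phi, ip, br, h] at hP)
  have h2 := hpos 2 (fun h => by simp [Phi, ip, br, h] at hP)
  have key : ∀ x y z w : Su2, ip (br x y) (br z w) = ip x z * ip y w - ip x w * ip y z :=
    fun x y z w => by simp only [ip, br, cross_dot_cross]
  have z1 : ∀ x : Su2, ip 0 x = 0 := fun x => by simp [ip]
  have z2 : ∀ x : Su2, ip x 0 = 0 := fun x => by simp [ip]
  have p01 := mul_pos h0 h1
  have p02 := mul_pos h0 h2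
  have p12 := mul_pos h1 h2
  change ip3 (frame a j) (frame a i) / ip3 (frame a i) (frame a i) = _
  fin_cases i <;> fin_cases j <;>
    simp [ip3, frame, Fin.sum_univ_three, key, h01, h02, h12, h10, h20, h21, z1, z2] <;>
    exact ne_of_gt (by nlinarith)

theorem leafMetric_frame {q r : ℝ} {a : Triple} (ha : a ∈ leaf q r) (i j : Fin 4) :
    leafMetric a (frame a i) (frame a j) = if i = j then -Phi a else 0 := by
  simp [leafMetric, frameCoord_frame ha, eq_comm]

theorem leafI_frame {q r : ℝ} {a : Triple} (ha : a ∈ leaf q r) (i : Fin 4) :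
    leafI a (frame a i) = ![frame a 1, -frame a 0, frame a 3, -frame a 2] i := by
  simp [leafI, frameCoord_frame ha]

theorem leafJ_frame {q r : ℝ} {a : Triple} (ha : a ∈ leaf q r) (i : Fin 4) :
    leafJ a (frame a i) = ![frame a 2, -frame a 3, -frame a 0, frame a 1] i := by
  simp [leafJ, frameCoord_frame ha]

theorem leafK_frame {q r : ℝ} {a : Triple} (ha : a ∈ leaf q r) (i : Fin 4) :
    leafK a (frame a i) = ![frame a 3, frame a 2, -frame a 1, -frame a 0] i := by
  simp [leafK, frameCoord_frame ha]

/-! ### Riemannian and hyperkähler geometry in coordinates -/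

/-- The coordinate space of 4-dimensional manifolds. -/
abbrev E4 : Type := Fin 4 → ℝ

/-- The Christoffel symbols of a metric `G`, as the vector `Γ(u, v)` at `x` that is determined by
`G(Γ(u, v), w) = ½ (∂_u G(v, w) + ∂_v G(u, w) - ∂_w G(u, v))` for all `w`. -/
def christoffel (G : E4 → E4 →L[ℝ] E4 →L[ℝ] ℝ) (x u v : E4) : E4 :=
  (G x).inverse ((1 / 2 : ℝ) •
    (fderiv ℝ G x u v + fderiv ℝ G x v u - ((fderiv ℝ G x).flip u).flip v))

/-- The Levi-Civita connection `∇_X Y` of a metric `G`. -/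
def covDeriv (G : E4 → E4 →L[ℝ] E4 →L[ℝ] ℝ) (X Y : E4 → E4) (x : E4) : E4 :=
  fderiv ℝ Y x (X x) + christoffel G x (X x) (Y x)

/-- The curvature tensor `R(u, v) w = ∇_u ∇_v w - ∇_v ∇_u w` at `x`, where `u, v, w` are extended
to constant vector fields (so that `[u, v] = 0`). -/
def curvature (G : E4 → E4 →L[ℝ] E4 →L[ℝ] ℝ) (x u v w : E4) : E4 :=
  covDeriv G (fun _ => u) (covDeriv G (fun _ => v) fun _ => w) x -
    covDeriv G (fun _ => v) (covDeriv G (fun _ => u) fun _ => w) x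

/-- The sectional curvature of `G` at `x` in the direction of `u, v`. -/
def sectionalCurvature (G : E4 → E4 →L[ℝ] E4 →L[ℝ] ℝ) (x u v : E4) : ℝ :=
  G x (curvature G x u v v) u / (G x u u * G x v v - G x u v ^ 2)

/-- `g` is a smooth Riemannian metric at the points of `S`. As usual when `S` is not open, such as
an open subset of a half-space, smoothness at a point means smoothness in a neighbourhood in the
coordinate space. -/
structure IsRiemannianOn (S : Set E4) (g : E4 → E4 →L[ℝ] E4 →L[ℝ] ℝ) : Prop where
  smooth : ∀ x ∈ S, ContDiffAt ℝ ∞ g x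
  symm : ∀ x ∈ S, ∀ u v, g x u v = g x v u
  pos : ∀ x ∈ S, ∀ u, u ≠ 0 → 0 < g x u u

/-- `I` is a complex structure on `S` (integrability being the vanishing of the Nijenhuis tensor)
and `g` is Kählerian with respect to `I`: it is Hermitian and `ω(u, v) = g(I u, v)` is closed. -/
structure IsKahlerOn (S : Set E4) (g : E4 → E4 →L[ℝ] E4 →L[ℝ] ℝ) (I : E4 → E4 →L[ℝ] E4) :
    Prop where
  smooth : ∀ x ∈ S, ContDiffAt ℝ ∞ I x
  sq : ∀ x ∈ S, ∀ u, I x (I x u) = -u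
  integrable : ∀ x ∈ S, ∀ u v : E4,
    VectorField.lieBracket ℝ (fun y => I y u) (fun y => I y v) x
      - I x (VectorField.lieBracket ℝ (fun y => I y u) (fun _ => v) x)
      - I x (VectorField.lieBracket ℝ (fun _ => u) (fun y => I y v) x)
      - VectorField.lieBracket ℝ (fun _ => u) (fun _ => v) x = 0
  hermitian : ∀ x ∈ S, ∀ u v, g x (I x u) (I x v) = g x u v
  closed : ∀ x ∈ S, ∀ u v w : E4,
    fderiv ℝ (fun y => g y (I y v) w) x u + fderiv ℝ (fun y => g y (I y w) u) x v
      + fderiv ℝ (fun y => g y (I y u) v) x w = 0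

/-- `(g, I, J, K)` is a hyperkähler structure on `S`. -/
structure IsHyperkahlerOn (S : Set E4) (g : E4 → E4 →L[ℝ] E4 →L[ℝ] ℝ)
    (I J K : E4 → E4 →L[ℝ] E4) : Prop where
  riemannian : IsRiemannianOn S g
  kahlerI : IsKahlerOn S g I
  kahlerJ : IsKahlerOn S g J
  kahlerK : IsKahlerOn S g K
  quaternion : ∀ x ∈ S, ∀ u, I x (J x (K x u)) = -u

/-! ### Curvature and extensions of the leaves -/

/-- `ψ : Ω → N` is a smooth local parametrization (the inverse of a chart) of the 4-dimensional
embedded submanifold `N` of `su(2)³`. -/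
structure IsLocalParam (N : Set Triple) (Ω : Set E4) (ψ : E4 → Triple) : Prop where
  isOpen : IsOpen Ω
  smooth : ContDiffOn ℝ ∞ ψ Ω
  immersion : ∀ x ∈ Ω, Function.Injective (fderiv ℝ ψ x)
  embedding : IsEmbedding (Ω.domRestrict ψ)
  image : ∃ V : Set Triple, IsOpen V ∧ ψ '' Ω = V ∩ N

/-- The metric of a leaf, in the coordinates given by a local parametrization `ψ`. -/
def leafMetricIn (ψ : E4 → Triple) (x : E4) : E4 →L[ℝ] E4 →L[ℝ] ℝ :=
  (leafMetric (ψ x)).bilinearComp (fderiv ℝ ψ x) (fderiv ℝ ψ x)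

/-- `k` is the sectional curvature of `N_{q,r}` at `a` in the direction of the tangent vectors
`w, w'`, computed in some local coordinates. -/
def HasSectionalCurvature (q r : ℝ) (a w w' : Triple) (k : ℝ) : Prop :=
  ∃ (Ω : Set E4) (ψ : E4 → Triple) (x u v : E4), IsLocalParam (leaf q r) Ω ψ ∧ x ∈ Ω ∧ ψ x = a ∧
    fderiv ℝ ψ x u = w ∧ fderiv ℝ ψ x v = w' ∧
    sectionalCurvature (leafMetricIn ψ) x u v = k

/-- The sectional curvature `κ_{q,r}(w, w')` of `N_{q,r}` at `a`: the `k` such that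
`HasSectionalCurvature q r a w w' k`, which does not depend on the local coordinates. -/
def leafSectionalCurvature (q r : ℝ) (a w w' : Triple) : ℝ :=
  Classical.epsilon (HasSectionalCurvature q r a w w')

/-- The hyperkähler structure of `N_{q,r}` extends to the point `p` of the closure of `N_{q,r}`:
some neighbourhood `U ∩ closure N_{q,r}` of `p` in the closure has a coordinate system `ψ : S → U ∩
closure N_{q,r}`, with a subset `S` of `ℝ⁴`, which is a smooth coordinate system of the manifold
`N_{q,r}` over the points of `N_{q,r}`, and there is a hyperkähler structure on `S` that agrees
there with the one of `N_{q,r}`.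

No smooth structure of the closure is prescribed, and the set `S` may be open, relatively open in a
half-space (an extension to a manifold with boundary), or any other set, such as the part of a chart
of a larger hyperkähler manifold, containing `N_{q,r}` as an open submanifold, that belongs to the
closure. -/
def HyperkahlerExtendsTo (q r : ℝ) (p : Triple) : Prop :=
  ∃ (U : Set Triple) (S : Set E4) (ψ : E4 → Triple),
    IsOpen U ∧ p ∈ U ∧ ψ '' S = U ∩ closure (leaf q r) ∧ IsEmbedding (S.domRestrict ψ) ∧
    IsLocalParam (leaf q r) (S ∩ ψ ⁻¹' leaf q r) ψ ∧
    ∃ (g : E4 → E4 →L[ℝ] E4 →L[ℝ] ℝ) (I J K : E4 → E4 →L[ℝ] E4),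
      IsHyperkahlerOn S g I J K ∧
      ∀ x ∈ S ∩ ψ ⁻¹' leaf q r, ∀ u,
        (∀ v, g x u v = leafMetric (ψ x) (fderiv ℝ ψ x u) (fderiv ℝ ψ x v)) ∧
        fderiv ℝ ψ x (I x u) = leafI (ψ x) (fderiv ℝ ψ x u) ∧
        fderiv ℝ ψ x (J x u) = leafJ (ψ x) (fderiv ℝ ψ x u) ∧
        fderiv ℝ ψ x (K x u) = leafK (ψ x) (fderiv ℝ ψ x u)

/-! ### Diffeomorphisms and the nilpotent orbit -/

/-- `f` is smooth on the subset `s` of a normed space: near each point of `s` it agrees on `s` with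
a smooth map that is defined on an open set. -/
def SmoothOnSet {E F : Type*} [NormedAddCommGroup E] [NormedSpace ℝ E] [NormedAddCommGroup F]
    [NormedSpace ℝ F] (f : E → F) (s : Set E) : Prop :=
  ∀ x ∈ s, ∃ (U : Set E) (f' : E → F), IsOpen U ∧ x ∈ U ∧ ContDiffOn ℝ ∞ f' U ∧ EqOn f f' (s ∩ U)

/-- The subsets (embedded submanifolds) `s` and `t` of normed spaces are diffeomorphic. -/
def AreDiffeomorphic {E F : Type*} [NormedAddCommGroup E] [NormedSpace ℝ E]
    [NormedAddCommGroup F] [NormedSpace ℝ F] (s : Set E) (t : Set F) : Prop :=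
  ∃ (f : E → F) (f' : F → E), MapsTo f s t ∧ MapsTo f' t s ∧ InvOn f' f s t ∧
    SmoothOnSet f s ∧ SmoothOnSet f' t

/-- The nilpotent orbit of `sl(2, ℂ)`: the nonzero `m` such that `ad m` is nilpotent. Matrices are
written as functions of two indices, so that the space of all matrices has a norm. -/
def nilpotentOrbit : Set (Fin 2 → Fin 2 → ℂ) :=
  {m | m ≠ 0 ∧ ∃ h : Matrix.of m ∈ LieAlgebra.SpecialLinear.sl (Fin 2) ℂ,
    IsNilpotent (LieAlgebra.ad ℂ (LieAlgebra.SpecialLinear.sl (Fin 2) ℂ) ⟨Matrix.of m, h⟩)}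

end

end HyperLie

/-! On a leaf the vectors `a 0`, `a 1`, `a 2` are orthogonal, so `[a 1, a 2] = s₀ • a 0` and
cyclically, with `s_k = Φ / |a k|²` (`structureFun`). Hence the frame has simple brackets: `[V₀,
V_{k+1}] = s_k V_{k+1}`, while `[V₁, V₂]` and `[V₁, V₃]` are multiples of `V₃` and `V₂`. Moreover
`V₀Φ = Φ (s₀ + s₁ + s₂)`, and the other `V_i` annihilate `Φ`. The Koszul formula then determines
`∇_{V₁}V₁` and `∇_{V₀}V₁` (`metric_curvature_of_frame`), and `Φ² = |a 0|² |a 1|² |a 2|²` turns the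
sectional curvature of `V₀, V₁` into `frameCurvature`, a polynomial in the squared lengths divided
by `(-Φ)³`.

At a boundary point `Φ = 0`. Since `r > 0`, only `a 2` can vanish, so the squared lengths are `q +
r`, `r`, `0` (`boundary_point`). The numerator tends to `(q + r)² r² / 2 > 0` and the denominator to
`0` from above: the curvature tends to `+∞`. A metric that is smooth and positive definite at a
point has bounded sectional curvature nearby (`exists_curvature_bound`), so the structure cannot
extend (`not_hyperkahlerExtendsTo`).

For the diffeomorphism, write a traceless matrix as `z = u + i v` in `ℂ³` with `-det = z ⬝ᵥ z`.
Nilpotency means `|u| = |v|` and `u ⟂ v`. A leaf point goes to `u = a 2` and `v` = `a 1` rescaled to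
the length of `a 2`. Conversely the leaf equations give the lengths of `a 0` and `a 1`,
orthogonality gives the line of `a 0`, and `Φ < 0` gives its sign. -/

namespace HyperLie

noncomputable section

set_option maxSynthPendingDepth 3

section

/-! ### The Levi-Civita connection in coordinates -/

/-- The map sending the derivative `T` of a metric to the Christoffel symbols of
the first kind `½ (T u v w + T v u w - T w u v)`. -/
def christoffelFirst :
    (E4 →L[ℝ] E4 →L[ℝ] E4 →L[ℝ] ℝ) →L[ℝ] (E4 →L[ℝ] E4 →L[ℝ] E4 →L[ℝ] ℝ) :=
  let F : (E4 →L[ℝ] E4 →L[ℝ] E4 →L[ℝ] ℝ) →L[ℝ] (E4 →L[ℝ] E4 →L[ℝ] E4 →L[ℝ] ℝ) :=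
    (ContinuousLinearMap.flipₗᵢ ℝ E4 E4 (E4 →L[ℝ] ℝ)).toContinuousLinearEquiv.toContinuousLinearMap
  let f : (E4 →L[ℝ] E4 →L[ℝ] ℝ) →L[ℝ] (E4 →L[ℝ] E4 →L[ℝ] ℝ) :=
    (ContinuousLinearMap.flipₗᵢ ℝ E4 E4 ℝ).toContinuousLinearEquiv.toContinuousLinearMap
  (1 / 2 : ℝ) • (ContinuousLinearMap.id ℝ _ + F -
    (ContinuousLinearMap.compL ℝ E4 (E4 →L[ℝ] E4 →L[ℝ] ℝ) (E4 →L[ℝ] E4 →L[ℝ] ℝ) f) ∘L F)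

theorem christoffelFirst_apply (T : E4 →L[ℝ] E4 →L[ℝ] E4 →L[ℝ] ℝ) (u v : E4) :
    christoffelFirst T u v =
      (1 / 2 : ℝ) • (T u v + T v u - ((T.flip u).flip v)) := by
  ext w
  simp [christoffelFirst]

/-- The Christoffel symbols of `G` as a field of bilinear maps. -/
def christoffelMap (G : E4 → E4 →L[ℝ] E4 →L[ℝ] ℝ) (x : E4) : E4 →L[ℝ] E4 →L[ℝ] E4 :=
  (ContinuousLinearMap.compL ℝ E4 (E4 →L[ℝ] ℝ) E4 (G x).inverse) ∘L
    (christoffelFirst (fderiv ℝ G x))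

variable {G : E4 → E4 →L[ℝ] E4 →L[ℝ] ℝ} {x : E4}

theorem christoffel_eq_christoffelMap (u v : E4) :
    christoffel G x u v = christoffelMap G x u v := by
  simp [christoffel, christoffelMap, christoffelFirst_apply]

theorem contDiffAt_christoffelMap (hG : ContDiffAt ℝ 2 G x) (hi : (G x).IsInvertible) :
    ContDiffAt ℝ 1 (christoffelMap G) x := by
  have h1 : ContDiffAt ℝ 1 (fderiv ℝ G) x := hG.fderiv_right (by norm_num)
  have h2 : ContDiffAt ℝ 1 (fun y => (G y).inverse) x :=
    (hi.contDiffAt_map_inverse).comp x (hG.of_le (by norm_num))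
  exact ((ContinuousLinearMap.compL ℝ E4 (E4 →L[ℝ] ℝ) E4).contDiff.contDiffAt.comp x h2).clm_comp
    (christoffelFirst.contDiff.contDiffAt.comp x h1)

theorem covDeriv_eq (X Y : E4 → E4) :
    covDeriv G X Y x = fderiv ℝ Y x (X x) + christoffelMap G x (X x) (Y x) := by
  rw [covDeriv, christoffel_eq_christoffelMap]

theorem fderiv_covDeriv (hG : ContDiffAt ℝ 2 G x) (hi : (G x).IsInvertible) {Y Z : E4 → E4}
    (hY : ContDiffAt ℝ 1 Y x) (hZ : ContDiffAt ℝ 2 Z x) (u : E4) :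
    fderiv ℝ (covDeriv G Y Z) x u =
      fderiv ℝ (fderiv ℝ Z) x u (Y x) + fderiv ℝ Z x (fderiv ℝ Y x u) +
      fderiv ℝ (christoffelMap G) x u (Y x) (Z x) + christoffelMap G x (fderiv ℝ Y x u) (Z x) +
      christoffelMap G x (Y x) (fderiv ℝ Z x u) := by
  have h1 : DifferentiableAt ℝ (fderiv ℝ Z) x :=
    (hZ.fderiv_right (m := 1) (by norm_num)).differentiableAt (by norm_num)
  have h2 : DifferentiableAt ℝ (christoffelMap G) x :=
    (contDiffAt_christoffelMap hG hi).differentiableAt (by norm_num)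
  have h3 : DifferentiableAt ℝ Y x := hY.differentiableAt (by norm_num)
  have h4 : DifferentiableAt ℝ Z x := hZ.differentiableAt (by norm_num)
  have h5 := (h1.hasFDerivAt.clm_apply h3.hasFDerivAt).add
    ((h2.hasFDerivAt.clm_apply h3.hasFDerivAt).clm_apply h4.hasFDerivAt)
  have h6 : covDeriv G Y Z =
      (fun y => fderiv ℝ Z y (Y y)) + fun y => christoffelMap G y (Y y) (Z y) := by
    ext1 y; exact covDeriv_eq Y Z
  rw [h6, h5.fderiv]
  simp only [add_apply, ContinuousLinearMap.comp_apply, ContinuousLinearMap.flip_apply]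
  abel

theorem curvature_eq (hG : ContDiffAt ℝ 2 G x) (hi : (G x).IsInvertible) (u v w : E4) :
    curvature G x u v w =
      fderiv ℝ (christoffelMap G) x u v w - fderiv ℝ (christoffelMap G) x v u w +
      christoffelMap G x u (christoffelMap G x v w) -
      christoffelMap G x v (christoffelMap G x u w) := by
  rw [curvature, covDeriv_eq (fun _ => u) (covDeriv G (fun _ => v) fun _ => w),
    covDeriv_eq (fun _ => v) (covDeriv G (fun _ => u) fun _ => w),
    fderiv_covDeriv hG hi contDiffAt_const contDiffAt_const,
    fderiv_covDeriv hG hi contDiffAt_const contDiffAt_const, covDeriv_eq, covDeriv_eq]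
  simp only [fderiv_fun_const, Pi.zero_apply, fderiv_zero, zero_apply, map_zero]
  abel_nf

/-- The curvature tensor computed with arbitrary vector fields. -/
theorem curvature_apply_fields (hG : ContDiffAt ℝ 2 G x) (hi : (G x).IsInvertible)
    {X Y Z : E4 → E4} (hX : ContDiffAt ℝ 1 X x) (hY : ContDiffAt ℝ 1 Y x)
    (hZ : ContDiffAt ℝ 2 Z x) :
    curvature G x (X x) (Y x) (Z x) =
      covDeriv G X (covDeriv G Y Z) x - covDeriv G Y (covDeriv G X Z) x -
      covDeriv G (VectorField.lieBracket ℝ X Y) Z x := by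
  -- Second derivatives of `Z` cancel by symmetry; the first derivatives of `X` and `Y` are absorbed
  -- by the bracket term.
  have hs : fderiv ℝ (fderiv ℝ Z) x (X x) (Y x) = fderiv ℝ (fderiv ℝ Z) x (Y x) (X x) :=
    (hZ.isSymmSndFDerivAt (by simp)).eq _ _
  rw [curvature_eq hG hi, covDeriv_eq, covDeriv_eq, covDeriv_eq,
    fderiv_covDeriv hG hi hX hZ, fderiv_covDeriv hG hi hY hZ, covDeriv_eq, covDeriv_eq,
    VectorField.lieBracket, hs]
  simp only [map_add, map_sub, sub_apply]
  abel

theorem metric_christoffelMap (hi : (G x).IsInvertible) (u v w : E4) :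
    G x (christoffelMap G x u v) w =
      1 / 2 * (fderiv ℝ G x u v w + fderiv ℝ G x v u w - fderiv ℝ G x w u v) := by
  have h : G x (christoffelMap G x u v) = christoffelFirst (fderiv ℝ G x) u v :=
    (hi.inverse_apply_eq.1 rfl).symm
  rw [h, christoffelFirst_apply]
  simp

/-- The Koszul formula. -/
theorem koszul (hG : DifferentiableAt ℝ G x) (hi : (G x).IsInvertible)
    (hs : ∀ᶠ y in 𝓝 x, ∀ u v, G y u v = G y v u) {X Y Z : E4 → E4}
    (hX : DifferentiableAt ℝ X x) (hY : DifferentiableAt ℝ Y x) (hZ : DifferentiableAt ℝ Z x) :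
    2 * G x (covDeriv G X Y x) (Z x) =
      fderiv ℝ (fun y => G y (Y y) (Z y)) x (X x) + fderiv ℝ (fun y => G y (X y) (Z y)) x (Y x)
      - fderiv ℝ (fun y => G y (X y) (Y y)) x (Z x)
      + G x (VectorField.lieBracket ℝ X Y x) (Z x) - G x (VectorField.lieBracket ℝ X Z x) (Y x)
      - G x (VectorField.lieBracket ℝ Y Z x) (X x) := by
  -- Leibniz rule for `G(A, B)`. In the Koszul combination the derivatives of the fields leave only
  -- `2 G(dY(X), Z)`, and those of `G` form the Christoffel symbol.
  have hd : ∀ {A B : E4 → E4}, DifferentiableAt ℝ A x → DifferentiableAt ℝ B x → ∀ u,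
      fderiv ℝ (fun y => G y (A y) (B y)) x u =
        fderiv ℝ G x u (A x) (B x) + G x (fderiv ℝ A x u) (B x) + G x (A x) (fderiv ℝ B x u) := by
    intro A B hA hB u
    rw [((hG.hasFDerivAt.clm_apply hA.hasFDerivAt).clm_apply hB.hasFDerivAt).fderiv]
    simp only [add_apply, ContinuousLinearMap.comp_apply, ContinuousLinearMap.flip_apply]
    ring
  have hs' := hs.self_of_nhds
  rw [hd hY hZ, hd hX hZ, hd hX hY, covDeriv_eq, map_add, add_apply, metric_christoffelMap hi]
  simp only [VectorField.lieBracket, map_sub, sub_apply]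
  rw [hs' (X x) (fderiv ℝ Z x (Y x)), hs' (Y x) (fderiv ℝ Z x (X x)),
    hs' (X x) (fderiv ℝ Y x (Z x))]
  ring

theorem isInvertible_of_pos (h : ∀ u, u ≠ 0 → 0 < G x u u) : (G x).IsInvertible := by
  have hinj : Function.Injective (G x) := by
    rw [injective_iff_map_eq_zero]
    intro u hu
    by_contra h0
    have := h u h0
    simp [hu] at this
  have hd : Module.finrank ℝ E4 = Module.finrank ℝ (E4 →L[ℝ] ℝ) := by
    rw [← (LinearMap.toContinuousLinearMap (𝕜 := ℝ) (E := E4) (F' := ℝ)).finrank_eq]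
    exact (Subspace.dual_finrank_eq (K := ℝ) (V := E4)).symm
  exact ⟨(LinearEquiv.ofInjectiveOfFinrankEq (G x).toLinearMap hinj hd).toContinuousLinearEquiv,
    by ext; rfl⟩

/-- Near a point where a metric is smooth and positive definite, the curvature is bounded. -/
theorem exists_curvature_bound (hG : ContDiffAt ℝ 2 G x) (hpos : ∀ u, u ≠ 0 → 0 < G x u u) :
    ∃ C : ℝ, ∀ᶠ y in 𝓝 x, ∀ u v, 0 ≤ G y u u ∧ 0 ≤ G y v v ∧
      |G y (curvature G y u v v) u| ≤ C * (G y u u * G y v v) := by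
  have hi := isInvertible_of_pos hpos
  have hne : (Metric.sphere (0 : E4) 1).Nonempty := NormedSpace.sphere_nonempty.2 zero_le_one
  -- Compactness of the unit sphere gives `m > 0` with `m ‖u‖² ≤ G x u u`; nearby, `m / 2` still
  -- works.
  obtain ⟨u₀, hu₀, hmin⟩ := (isCompact_sphere (0 : E4) 1).exists_isMinOn hne
    (f := fun u => G x u u) (by fun_prop)
  set m := G x u₀ u₀ with hm
  have hm0 : 0 < m := hpos u₀ (ne_zero_of_mem_unit_sphere ⟨u₀, hu₀⟩)
  have hlow : ∀ u, m * ‖u‖ ^ 2 ≤ G x u u := by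
    intro u
    rcases eq_or_ne u 0 with rfl | hu
    · simp
    have hn : 0 < ‖u‖ := norm_pos_iff.2 hu
    have := hmin (a := ‖u‖⁻¹ • u) (by simp [norm_smul, hn.ne'])
    simp only [mem_ofPred_eq, map_smul, smul_apply, smul_eq_mul] at this
    calc m * ‖u‖ ^ 2 ≤ ‖u‖⁻¹ * (‖u‖⁻¹ * G x u u) * ‖u‖ ^ 2 := by gcongr
      _ = G x u u := by field_simp
  have hΓ := contDiffAt_christoffelMap hG hi
  have hc : ContinuousAt (fun y => ‖G y‖ *
      (2 * ‖fderiv ℝ (christoffelMap G) y‖ + 2 * ‖christoffelMap G y‖ ^ 2)) x := by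
    have h1 := hG.continuousAt
    have h2 := hΓ.continuousAt
    have h3 := (hΓ.fderiv_right (m := 0) (by norm_num)).continuousAt
    fun_prop
  -- The product bounds the curvature form through `dΓ` and `Γ ∘ Γ`; adding `1` makes the bound hold
  -- on a neighbourhood by continuity.
  set B := ‖G x‖ * (2 * ‖fderiv ℝ (christoffelMap G) x‖ + 2 * ‖christoffelMap G x‖ ^ 2) + 1
  have hB : ∀ᶠ y in 𝓝 x, ‖G y‖ * (2 * ‖fderiv ℝ (christoffelMap G) y‖ +
      2 * ‖christoffelMap G y‖ ^ 2) < B := hc.eventually_lt_const (lt_add_one _)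
  have hnear : ∀ᶠ y in 𝓝 x, ‖G y - G x‖ < m / 2 := by
    have : ContinuousAt (fun y => ‖G y - G x‖) x := by
      have h1 := hG.continuousAt
      fun_prop
    exact this.eventually_lt_const (by simpa using hm0)
  have hinv : ∀ᶠ y in 𝓝 x, (G y).IsInvertible := by
    obtain ⟨e, he⟩ := hi
    have := hG.continuousAt.eventually (he ▸ e.nhds)
    exact this.mono fun y ⟨e', he'⟩ => ⟨e', he'⟩
  -- One factor `m / 2` converts `‖u‖²` into `G y u u`, the other `‖v‖²` into `G y v v`.
  refine ⟨B / (m / 2) ^ 2, ?_⟩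
  filter_upwards [hB, hnear, hinv, hG.eventually (by simp)] with y hBy hny hiy hGy u v
  have hlow' : ∀ u, m / 2 * ‖u‖ ^ 2 ≤ G y u u := by
    intro u
    have h1 : |(G y - G x) u u| ≤ ‖G y - G x‖ * ‖u‖ * ‖u‖ := (G y - G x).le_opNorm₂ u u
    have h2 : ‖G y - G x‖ * ‖u‖ * ‖u‖ ≤ m / 2 * ‖u‖ ^ 2 := by
      rw [mul_assoc, ← sq]; gcongr
    have h3 := (abs_le.1 (h1.trans h2)).1
    have h4 := hlow u
    simp only [sub_apply] at h3
    linarith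
  have hu := hlow' u
  have hv := hlow' v
  refine ⟨le_trans (by positivity) hu, le_trans (by positivity) hv, ?_⟩
  set Γ := christoffelMap G y
  set D := fderiv ℝ (christoffelMap G) y
  have hD : ∀ a b c, ‖D a b c‖ ≤ ‖D‖ * ‖a‖ * ‖b‖ * ‖c‖ := fun a b c =>
    ((D a b).le_opNorm c).trans (by gcongr; exact D.le_opNorm₂ a b)
  have hΓΓ : ∀ a b c, ‖Γ a (Γ b c)‖ ≤ ‖Γ‖ ^ 2 * ‖a‖ * ‖b‖ * ‖c‖ := fun a b c =>
    (Γ.le_opNorm₂ a (Γ b c)).trans (by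
      calc ‖Γ‖ * ‖a‖ * ‖Γ b c‖ ≤ ‖Γ‖ * ‖a‖ * (‖Γ‖ * ‖b‖ * ‖c‖) := by
            gcongr; exact Γ.le_opNorm₂ b c
        _ = _ := by ring)
  have hR : ‖curvature G y u v v‖ ≤ (2 * ‖D‖ + 2 * ‖Γ‖ ^ 2) * ‖u‖ * ‖v‖ ^ 2 := by
    rw [curvature_eq hGy hiy]
    calc _ ≤ ‖D u v v‖ + ‖D v u v‖ + ‖Γ u (Γ v v)‖ + ‖Γ v (Γ u v)‖ :=
          (norm_sub_le _ _).trans (by gcongr; exact (norm_add_le _ _).trans (by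
            gcongr; exact norm_sub_le _ _))
      _ ≤ _ := by
          have h1 := hD u v v
          have h2 := hD v u v
          have h3 := hΓΓ u v v
          have h4 := hΓΓ v u v
          nlinarith
  calc |G y (curvature G y u v v) u| ≤ ‖G y‖ * ‖curvature G y u v v‖ * ‖u‖ :=
        (G y).le_opNorm₂ _ _
    _ ≤ ‖G y‖ * ((2 * ‖D‖ + 2 * ‖Γ‖ ^ 2) * ‖u‖ * ‖v‖ ^ 2) * ‖u‖ := by gcongr
    _ = ‖G y‖ * (2 * ‖D‖ + 2 * ‖Γ‖ ^ 2) * (‖u‖ ^ 2 * ‖v‖ ^ 2) := by ring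
    _ ≤ B * (‖u‖ ^ 2 * ‖v‖ ^ 2) := by gcongr
    _ = B / (m / 2) ^ 2 * ((m / 2 * ‖u‖ ^ 2) * (m / 2 * ‖v‖ ^ 2)) := by field_simp
    _ ≤ B / (m / 2) ^ 2 * (G y u u * G y v v) := by
        have : 0 ≤ B := by positivity
        gcongr
        exact le_trans (by positivity) hu

end

/-! ### Curvature of a metric with a conformal frame -/

section

variable {G : E4 → E4 →L[ℝ] E4 →L[ℝ] ℝ} {x : E4}

/-- The connection is tensorial in the direction `X` and local in `Y`: hence a pointwise equality
for one and an equality of germs for the other. -/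
theorem covDeriv_congr {X X' Y Y' : E4 → E4} (hX : X x = X' x) (hY : Y =ᶠ[𝓝 x] Y') :
    covDeriv G X Y x = covDeriv G X' Y' x := by
  rw [covDeriv, covDeriv, hX, hY.fderiv_eq, hY.eq_of_nhds]

theorem covDeriv_smul_right {X Y : E4 → E4} {f : E4 → ℝ} (hf : DifferentiableAt ℝ f x)
    (hY : DifferentiableAt ℝ Y x) :
    covDeriv G X (fun y => f y • Y y) x = fderiv ℝ f x (X x) • Y x + f x • covDeriv G X Y x := by
  rw [covDeriv_eq, covDeriv_eq, fderiv_fun_smul hf hY]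
  simp only [add_apply, smul_apply, ContinuousLinearMap.smulRight_apply, map_smul, smul_add]
  abel

theorem covDeriv_smul_left {X Y : E4 → E4} (f : E4 → ℝ) :
    covDeriv G (fun y => f y • X y) Y x = f x • covDeriv G X Y x := by
  simp only [covDeriv_eq, map_smul, smul_apply, smul_add]

/-- The sectional curvature of a metric with a conformal frame `W₀, …, W₃` for which
`[W₀, Wᵢ] = bᵢ Wᵢ`, `[W₁, W₂] ∝ W₃`, `[W₁, W₃] ∝ W₂`, and the conformal factor `ρ` varies only in
the direction of `W₀`. -/
theorem metric_curvature_of_frame {Ω : Set E4} (hΩ : IsOpen Ω)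
    (hG : ∀ y ∈ Ω, ContDiffAt ℝ 2 G y) (hs : ∀ y ∈ Ω, ∀ u v, G y u v = G y v u)
    (hi : ∀ y ∈ Ω, (G y).IsInvertible)
    {W : Fin 4 → E4 → E4} (hW : ∀ y ∈ Ω, ∀ i, ContDiffAt ℝ 2 (W i) y)
    {ρ D α : E4 → ℝ} {b : Fin 4 → E4 → ℝ} {m n : E4 → ℝ}
    (hGW : ∀ y ∈ Ω, ∀ i j, G y (W i y) (W j y) = if i = j then ρ y else 0)
    (hsep : ∀ y ∈ Ω, ∀ v, (∀ i, G y v (W i y) = 0) → v = 0)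
    (hρ : ∀ y ∈ Ω, ρ y ≠ 0)
    (hρD : ∀ y ∈ Ω, ∀ i, fderiv ℝ ρ y (W i y) = if i = 0 then D y else 0)
    (hb : ∀ y ∈ Ω, ∀ i, i ≠ 0 → VectorField.lieBracket ℝ (W 0) (W i) y = b i y • W i y)
    (hm : ∀ y ∈ Ω, VectorField.lieBracket ℝ (W 1) (W 2) y = m y • W 3 y)
    (hn : ∀ y ∈ Ω, VectorField.lieBracket ℝ (W 1) (W 3) y = n y • W 2 y)
    (hα : ∀ y ∈ Ω, α y = b 1 y - D y / (2 * ρ y))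
    (hx : x ∈ Ω) (hαx : DifferentiableAt ℝ α x) (hDx : DifferentiableAt ℝ D x)
    (hρx : DifferentiableAt ℝ ρ x) :
    G x (curvature G x (W 0 x) (W 1 x) (W 1 x)) (W 0 x) =
      ρ x * (fderiv ℝ α x (W 0 x) - α x * b 1 x) := by
  have hd : ∀ y ∈ Ω, ∀ i, DifferentiableAt ℝ (W i) y := fun y hy i =>
    (hW y hy i).differentiableAt (by norm_num)
  have hfd : ∀ y ∈ Ω, ∀ i j k, fderiv ℝ (fun z => G z (W j z) (W k z)) y (W i y) =
      if j = k then (if i = 0 then D y else 0) else 0 := by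
    intro y hy i j k
    have h1 : (fun z => G z (W j z) (W k z)) =ᶠ[𝓝 y] fun z => if j = k then ρ z else 0 :=
      (hΩ.eventually_mem hy).mono fun z hz => hGW z hz j k
    rw [h1.fderiv_eq]
    by_cases hjk : j = k
    · simp [hjk, hρD y hy]
    · simp [hjk]
  have hk : ∀ y ∈ Ω, ∀ i j k, 2 * G y (covDeriv G (W i) (W j) y) (W k y) =
      (if j = k then (if i = 0 then D y else 0) else 0)
      + (if i = k then (if j = 0 then D y else 0) else 0)
      - (if i = j then (if k = 0 then D y else 0) else 0)
      + G y (VectorField.lieBracket ℝ (W i) (W j) y) (W k y)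
      - G y (VectorField.lieBracket ℝ (W i) (W k) y) (W j y)
      - G y (VectorField.lieBracket ℝ (W j) (W k) y) (W i y) := by
    intro y hy i j k
    rw [koszul ((hG y hy).differentiableAt (by norm_num)) (hi y hy)
      ((hΩ.eventually_mem hy).mono fun z hz => hs z hz) (hd y hy i) (hd y hy j) (hd y hy k),
      hfd y hy, hfd y hy, hfd y hy]
  have hself : ∀ y i, VectorField.lieBracket ℝ (W i) (W i) y = 0 := fun y i => by
    simp [VectorField.lieBracket]
  have hswap : ∀ y i, VectorField.lieBracket ℝ (W i) (W 0) y =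
      - VectorField.lieBracket ℝ (W 0) (W i) y := fun y i => by
    simp [VectorField.lieBracket]
  -- Koszul pairs this with each `W k`. Only `k = 0` survives: `2 G(∇_{W₁}W₁, W₀) = 2 b₁ ρ - D`.
  have h11 : ∀ y ∈ Ω, covDeriv G (W 1) (W 1) y = α y • W 0 y := by
    intro y hy
    rw [← sub_eq_zero]
    refine hsep y hy _ fun k => ?_
    have h := hk y hy 1 1 k
    have hr := hρ y hy
    have ha : α y * ρ y = b 1 y * ρ y - D y / 2 := by rw [hα y hy]; field_simp
    fin_cases k <;>
      simp [hself, hswap, hb y hy, hm y hy, hn y hy, hGW y hy] at h ⊢ <;> linarith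
  -- Only `k = 1` survives, and there the two bracket terms cancel, leaving the derivative of `ρ`.
  have h01 : ∀ y ∈ Ω, covDeriv G (W 0) (W 1) y = (D y / (2 * ρ y)) • W 1 y := by
    intro y hy
    rw [← sub_eq_zero]
    refine hsep y hy _ fun k => ?_
    have h := hk y hy 0 1 k
    have hr := hρ y hy
    have ha : D y / (2 * ρ y) * ρ y = D y / 2 := by field_simp
    fin_cases k <;>
      simp [hself, hswap, hb y hy, hm y hy, hn y hy, hGW y hy] at h ⊢ <;> linarith
  have h00 : G x (covDeriv G (W 0) (W 0) x) (W 0 x) = D x / 2 := by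
    have h := hk x hx 0 0 0
    simp [hself] at h
    linarith
  have hβx : DifferentiableAt ℝ (fun y => D y / (2 * ρ y)) x := by
    simp only [div_eq_mul_inv]
    exact hDx.fun_mul ((hρx.const_mul 2).fun_inv (mul_ne_zero two_ne_zero (hρ x hx)))
  have e11 : covDeriv G (W 1) (W 1) =ᶠ[𝓝 x] fun y => α y • W 0 y :=
    (hΩ.eventually_mem hx).mono h11
  have e01 : covDeriv G (W 0) (W 1) =ᶠ[𝓝 x] fun y => (D y / (2 * ρ y)) • W 1 y :=
    (hΩ.eventually_mem hx).mono h01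
  -- Pairing with `W 0` leaves `ρ W₀(α) + α D / 2 - (D / (2ρ)) α ρ - b₁ α ρ`, in which the two terms
  -- with `D` cancel.
  rw [curvature_apply_fields (hG x hx) (hi x hx) ((hW x hx 0).of_le (by norm_num))
      ((hW x hx 1).of_le (by norm_num)) (hW x hx 1),
    covDeriv_congr rfl e11, covDeriv_congr rfl e01, covDeriv_smul_right hαx (hd x hx 0),
    covDeriv_smul_right hβx (hd x hx 1),
    covDeriv_congr (X' := fun y => b 1 y • W 1 y) (hb x hx 1 (by decide)) (.refl _ _),
    covDeriv_smul_left, h11 x hx]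
  simp only [map_sub, map_add, map_smul, sub_apply, add_apply, smul_apply, h00, hGW x hx,
    smul_eq_mul]
  have hr := hρ x hx
  simp
  field_simp
  ring

end

section

/-! ### Algebra of the frame -/

theorem ip_comm (x y : Su2) : ip x y = ip y x := dotProduct_comm x y

theorem ip_add_left (x y z : Su2) : ip (x + y) z = ip x z + ip y z := add_dotProduct x y z

theorem ip_add_right (x y z : Su2) : ip x (y + z) = ip x y + ip x z := dotProduct_add x y z

theorem ip_smul_left (c : ℝ) (x y : Su2) : ip (c • x) y = c * ip x y := smul_dotProduct c x y

theorem ip_smul_right (c : ℝ) (x y : Su2) : ip x (c • y) = c * ip x y := dotProduct_smul c x y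

theorem ip_neg_left (x y : Su2) : ip (-x) y = -ip x y := neg_dotProduct x y

theorem ip_neg_right (x y : Su2) : ip x (-y) = -ip x y := dotProduct_neg x y

theorem ip_zero_left (x : Su2) : ip 0 x = 0 := zero_dotProduct x

theorem ip_zero_right (x : Su2) : ip x 0 = 0 := dotProduct_zero x

theorem ip_self_nonneg (x : Su2) : 0 ≤ ip x x := by
  simp only [ip, dotProduct]
  exact Finset.sum_nonneg fun i _ => mul_self_nonneg (x i)

theorem ip_br_br (x y z w : Su2) :
    ip (br x y) (br z w) = ip x z * ip y w - ip x w * ip y z := by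
  simp only [ip, br, cross_dot_cross]

theorem br_smul_left (c : ℝ) (x y : Su2) : br (c • x) y = c • br x y := by simp [br]

theorem br_smul_right (c : ℝ) (x y : Su2) : br x (c • y) = c • br x y := by simp [br]

theorem br_neg_left (x y : Su2) : br (-x) y = -br x y := by simp [br]

theorem br_neg_right (x y : Su2) : br x (-y) = -br x y := by simp [br]

theorem br_add_left (x y z : Su2) : br (x + y) z = br x z + br y z := by simp [br]

theorem br_add_right (x y z : Su2) : br x (y + z) = br x y + br x z := by simp [br]

theorem br_zero_left (x : Su2) : br 0 x = 0 := by simp [br]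

theorem br_zero_right (x : Su2) : br x 0 = 0 := by simp [br]

theorem br_self (x : Su2) : br x x = 0 := cross_self x

theorem br_anticomm (x y : Su2) : br x y = -br y x := (cross_anticomm y x).symm

/-- Cramer's rule. -/
theorem Phi_smul_eq (a : Triple) (v : Su2) :
    Phi a • v = ip v (a 0) • br (a 1) (a 2) + ip v (a 1) • br (a 2) (a 0) +
      ip v (a 2) • br (a 0) (a 1) := by
  ext k
  fin_cases k <;>
    simp [Phi, ip, br, cross_apply, dotProduct, Fin.sum_univ_three] <;> ring

theorem eq_zero_of_ip_eq_zero {a : Triple} (ha : Phi a ≠ 0) {v : Su2}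
    (h : ∀ k, ip v (a k) = 0) : v = 0 := by
  have := Phi_smul_eq a v
  simp only [h, zero_smul, add_zero] at this
  exact (smul_eq_zero.1 this).resolve_left ha

/-- The structure functions `Φ / ⟨aₖ, aₖ⟩` of the frame. -/
def structureFun (a : Triple) (k : Fin 3) : ℝ := Phi a / ip (a k) (a k)

variable {q r : ℝ} {a : Triple}

theorem ip_self_pos_of_mem (ha : a ∈ leaf q r) (k : Fin 3) : 0 < ip (a k) (a k) := by
  refine (ip_self_nonneg _).lt_of_ne fun h => ?_
  have h0 : a k = 0 := dotProduct_self_eq_zero.1 h.symm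
  have := ha.1.ne
  fin_cases k <;> simp at h0 <;>
    simp [Phi, h0, br_zero_left, br_zero_right, ip_zero_left, ip_zero_right] at this

theorem structureFun_mul (ha : a ∈ leaf q r) (k : Fin 3) :
    structureFun a k * ip (a k) (a k) = Phi a :=
  div_mul_cancel₀ _ (ip_self_pos_of_mem ha k).ne'

theorem structureFun_neg (ha : a ∈ leaf q r) (k : Fin 3) : structureFun a k < 0 :=
  div_neg_of_neg_of_pos ha.1 (ip_self_pos_of_mem ha k)

theorem Phi_eq_one (a : Triple) : ip (a 1) (br (a 2) (a 0)) = Phi a := by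
  simp [Phi, ip, br, cross_apply, dotProduct, Fin.sum_univ_three]; ring

theorem Phi_eq_two (a : Triple) : ip (a 2) (br (a 0) (a 1)) = Phi a := by
  simp [Phi, ip, br, cross_apply, dotProduct, Fin.sum_univ_three]; ring

theorem ip_br_left (x y : Su2) : ip x (br x y) = 0 := dot_self_cross x y

theorem ip_br_right (x y : Su2) : ip x (br y x) = 0 := dot_cross_self y x

/-- The cross product of two members of an orthogonal triple is a multiple of the third; pairing
with `a 0` produces `Φ` and fixes the coefficient. -/
theorem br_one_two (ha : a ∈ leaf q r) : br (a 1) (a 2) = structureFun a 0 • a 0 := by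
  rw [← sub_eq_zero]
  refine eq_zero_of_ip_eq_zero ha.1.ne fun k => ?_
  rw [sub_eq_add_neg, ip_add_left, ip_neg_left, ip_smul_left, ip_comm]
  fin_cases k
  · have := structureFun_mul ha 0
    simp only [Phi] at this
    simp [this]
  · simp [ip_br_left, ha.2.1 0 1 (by decide)]
  · simp [ip_br_right, ha.2.1 0 2 (by decide)]

theorem br_two_zero (ha : a ∈ leaf q r) : br (a 2) (a 0) = structureFun a 1 • a 1 := by
  rw [← sub_eq_zero]
  refine eq_zero_of_ip_eq_zero ha.1.ne fun k => ?_
  rw [sub_eq_add_neg, ip_add_left, ip_neg_left, ip_smul_left, ip_comm]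
  fin_cases k
  · simp [ip_br_right, ha.2.1 1 0 (by decide)]
  · have := (structureFun_mul ha 1).symm
    simp [Phi_eq_one, this]
  · simp [ip_br_left, ha.2.1 1 2 (by decide)]

theorem br_zero_one (ha : a ∈ leaf q r) : br (a 0) (a 1) = structureFun a 2 • a 2 := by
  rw [← sub_eq_zero]
  refine eq_zero_of_ip_eq_zero ha.1.ne fun k => ?_
  rw [sub_eq_add_neg, ip_add_left, ip_neg_left, ip_smul_left, ip_comm]
  fin_cases k
  · simp [ip_br_left, ha.2.1 2 0 (by decide)]
  · simp [ip_br_right, ha.2.1 2 1 (by decide)]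
  · have := (structureFun_mul ha 2).symm
    simp [Phi_eq_two, this]

theorem br_two_one (ha : a ∈ leaf q r) : br (a 2) (a 1) = -(structureFun a 0 • a 0) := by
  rw [br_anticomm, br_one_two ha]

theorem br_zero_two (ha : a ∈ leaf q r) : br (a 0) (a 2) = -(structureFun a 1 • a 1) := by
  rw [br_anticomm, br_two_zero ha]

theorem br_one_zero (ha : a ∈ leaf q r) : br (a 1) (a 0) = -(structureFun a 2 • a 2) := by
  rw [br_anticomm, br_zero_one ha]

theorem frame_of_mem (ha : a ∈ leaf q r) : frame a =
    ![![structureFun a 0 • a 0, structureFun a 1 • a 1, structureFun a 2 • a 2],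
      ![0, -(structureFun a 2 • a 2), structureFun a 1 • a 1],
      ![structureFun a 2 • a 2, 0, -(structureFun a 0 • a 0)],
      ![-(structureFun a 1 • a 1), structureFun a 0 • a 0, 0]] := by
  rw [frame, br_one_two ha, br_two_zero ha, br_zero_one ha, br_two_one ha, br_zero_two ha,
    br_one_zero ha]

/-- The Gram determinant of an orthogonal triple. -/
theorem Phi_sq (ha : a ∈ leaf q r) :
    Phi a ^ 2 = ip (a 0) (a 0) * ip (a 1) (a 1) * ip (a 2) (a 2) := by
  have h := ip_br_br (a 1) (a 2) (a 1) (a 2)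
  rw [br_one_two ha, ip_smul_left, ip_smul_right, ha.2.1 1 2 (by decide)] at h
  have h2 := structureFun_mul ha 0
  rw [← h2] at *
  linear_combination ip (a 0) (a 0) * h

/-! ### Tangent vectors of the leaves -/

/-- The linearization at `a` of the equations of the leaves. -/
structure IsTangent (a w : Triple) : Prop where
  orthogonal : ∀ i j, i ≠ j → ip (w i) (a j) + ip (a i) (w j) = 0
  zero_one : ip (w 0) (a 0) = ip (w 1) (a 1)
  one_two : ip (w 1) (a 1) = ip (w 2) (a 2)

theorem isTangent_frame (a : Triple) (i : Fin 4) : IsTangent a (frame a i) := by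
  constructor
  · intro j k h
    fin_cases i <;> fin_cases j <;> fin_cases k <;> first | exact absurd rfl h | skip
    all_goals
      simp [frame, ip, br, cross_apply, dotProduct, Fin.sum_univ_three]
    all_goals ring
  · fin_cases i <;> simp [frame, ip, br, cross_apply, dotProduct, Fin.sum_univ_three] <;> ring
  · fin_cases i <;> simp [frame, ip, br, cross_apply, dotProduct, Fin.sum_univ_three] <;> ring

theorem IsTangent.add {w w' : Triple} (h : IsTangent a w) (h' : IsTangent a w') :
    IsTangent a (w + w') := by
  refine ⟨fun i j hij => ?_, ?_, ?_⟩ <;> simp only [Pi.add_apply, ip_add_left, ip_add_right]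
  · linear_combination h.orthogonal i j hij + h'.orthogonal i j hij
  · rw [h.zero_one, h'.zero_one]
  · rw [h.one_two, h'.one_two]

theorem IsTangent.smul {w : Triple} (c : ℝ) (h : IsTangent a w) : IsTangent a (c • w) := by
  refine ⟨fun i j hij => ?_, ?_, ?_⟩ <;> simp only [Pi.smul_apply, ip_smul_left, ip_smul_right]
  · linear_combination c * h.orthogonal i j hij
  · rw [h.zero_one]
  · rw [h.one_two]

/-- The nine numbers `⟨w i, a j⟩` split into blocks. The diagonal ones are equal and have weighted
sum zero; each pair `(i, j)`, `(j, i)` has sum zero and satisfies one more weighted relation. The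
weights are structure functions, all negative, so no block is degenerate. -/
theorem IsTangent.eq_zero (ha : a ∈ leaf q r) {w : Triple} (hw : IsTangent a w)
    (h : ∀ i, ip3 w (frame a i) = 0) : w = 0 := by
  have s0 := structureFun_neg ha 0
  have s1 := structureFun_neg ha 1
  have s2 := structureFun_neg ha 2
  have h0 := h 0
  have h1 := h 1
  have h2 := h 2
  have h3 := h 3
  simp [frame_of_mem ha, ip3, Fin.sum_univ_three, ip_smul_right, ip_neg_right,
    ip_zero_right] at h0 h1 h2 h3
  have t01 := hw.orthogonal 0 1 (by decide)
  have t02 := hw.orthogonal 0 2 (by decide)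
  have t12 := hw.orthogonal 1 2 (by decide)
  rw [ip_comm (a _)] at t01 t02 t12
  have d0 := hw.zero_one
  have d1 := hw.one_two
  have c1 : ip (w 1) (a 1) = 0 := by
    have : (structureFun a 0 + structureFun a 1 + structureFun a 2) * ip (w 1) (a 1) = 0 := by
      linear_combination h0 - structureFun a 0 * d0 + structureFun a 2 * d1
    exact (mul_eq_zero.1 this).resolve_left (by linarith)
  have c12 : ip (w 1) (a 2) = 0 := by
    have : (structureFun a 1 + structureFun a 2) * ip (w 1) (a 2) = 0 := by
      linear_combination structureFun a 1 * t12 - h1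
    exact (mul_eq_zero.1 this).resolve_left (by linarith)
  have c02 : ip (w 0) (a 2) = 0 := by
    have : (structureFun a 0 + structureFun a 2) * ip (w 0) (a 2) = 0 := by
      linear_combination structureFun a 0 * t02 + h2
    exact (mul_eq_zero.1 this).resolve_left (by linarith)
  have c01 : ip (w 0) (a 1) = 0 := by
    have : (structureFun a 0 + structureFun a 1) * ip (w 0) (a 1) = 0 := by
      linear_combination structureFun a 0 * t01 - h3
    exact (mul_eq_zero.1 this).resolve_left (by linarith)
  funext k
  refine eq_zero_of_ip_eq_zero ha.1.ne fun j => ?_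
  fin_cases k <;> fin_cases j <;> simp <;> linarith

theorem frameCoord_apply (a : Triple) (i : Fin 4) (w : Triple) :
    frameCoord a i w = ip3 w (frame a i) / ip3 (frame a i) (frame a i) := rfl

theorem ip3_frame_self_ne_zero (ha : a ∈ leaf q r) (i : Fin 4) :
    ip3 (frame a i) (frame a i) ≠ 0 := by
  intro h
  have := frameCoord_frame ha i i
  rw [frameCoord_apply, h] at this
  simp at this

/-- Tangent vectors are combinations of the frame. -/
theorem IsTangent.eq_sum (ha : a ∈ leaf q r) {w : Triple} (hw : IsTangent a w) :
    w = ∑ i, frameCoord a i w • frame a i := by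
  have hz : w + (-1 : ℝ) • ∑ i, frameCoord a i w • frame a i = 0 := by
    refine IsTangent.eq_zero ha (hw.add (IsTangent.smul _ ?_)) fun j => ?_
    · simp only [Fin.sum_univ_four]
      exact ((((isTangent_frame a 0).smul _).add ((isTangent_frame a 1).smul _)).add
        ((isTangent_frame a 2).smul _)).add ((isTangent_frame a 3).smul _)
    · have h : frameCoord a j (w + (-1 : ℝ) • ∑ i, frameCoord a i w • frame a i) = 0 := by
        simp [map_add, map_smul, map_sum, frameCoord_frame ha]
      rw [frameCoord_apply, div_eq_zero_iff] at h
      exact h.resolve_right (ip3_frame_self_ne_zero ha j)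
  rw [neg_one_smul, ← sub_eq_add_neg, sub_eq_zero] at hz
  exact hz

/-! ### Derivatives of polynomial maps on `su(2)³` -/

/-- The maps to be differentiated are polynomials of degree at most three, so the derivative is the
coefficient of `t` in an exact expansion along a line. -/
theorem fderiv_eq_of_expansion {E F : Type*} [NormedAddCommGroup E] [NormedSpace ℝ E]
    [NormedAddCommGroup F] [NormedSpace ℝ F] {f : E → F} {a w : E} (hf : DifferentiableAt ℝ f a)
    {L M K : F} (h : ∀ t : ℝ, f (a + t • w) = f a + t • L + t ^ 2 • M + t ^ 3 • K) :
    fderiv ℝ f a w = L := by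
  have h1 : HasDerivAt (fun t : ℝ => f (a + t • w)) (fderiv ℝ f a w) 0 :=
    hf.hasFDerivAt.hasLineDerivAt w
  have h2 : HasDerivAt (fun t : ℝ => f a + t • L + t ^ 2 • M + t ^ 3 • K) L 0 := by
    have h : HasDerivAt (fun t : ℝ => f a + t • L + t ^ 2 • M + t ^ 3 • K) _ 0 :=
      ((((hasDerivAt_id (0 : ℝ)).smul_const L).const_add (f a)).add
      (((hasDerivAt_id (0 : ℝ)).pow 2).smul_const M)).add
      (((hasDerivAt_id (0 : ℝ)).pow 3).smul_const K)
    simpa using h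
  exact h1.unique (h2.congr_of_eventuallyEq (.of_forall h))

theorem contDiff_ip_apply {n : WithTop ℕ∞} (i j : Fin 3) :
    ContDiff ℝ n fun a : Triple => ip (a i) (a j) := by
  simp only [ip, dotProduct]
  fun_prop

theorem contDiff_br_apply {n : WithTop ℕ∞} (i j : Fin 3) :
    ContDiff ℝ n fun a : Triple => br (a i) (a j) := by
  simp only [br, cross_apply]
  rw [contDiff_pi]
  intro k
  fin_cases k <;> simp <;> fun_prop

theorem contDiff_Phi {n : WithTop ℕ∞} : ContDiff ℝ n Phi := by
  unfold Phi
  simp only [ip, dotProduct, br, cross_apply, Fin.sum_univ_three]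
  simp
  fun_prop

theorem contDiff_frame {n : WithTop ℕ∞} (i : Fin 4) : ContDiff ℝ n fun a => frame a i := by
  rw [contDiff_pi]
  intro k
  fin_cases i <;> fin_cases k <;>
    first | exact contDiff_br_apply _ _ | exact contDiff_const

theorem fderiv_ip_apply (a w : Triple) (i j : Fin 3) :
    fderiv ℝ (fun a : Triple => ip (a i) (a j)) a w = ip (w i) (a j) + ip (a i) (w j) := by
  refine fderiv_eq_of_expansion (M := ip (w i) (w j)) (K := 0)
    ((contDiff_ip_apply (n := 1) i j).differentiable (by norm_num) a) fun t => ?_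
  simp only [Pi.add_apply, Pi.smul_apply, ip_add_left, ip_add_right, ip_smul_left, ip_smul_right,
    smul_eq_mul]
  ring

theorem fderiv_Phi (a w : Triple) :
    fderiv ℝ Phi a w =
      ip (w 0) (br (a 1) (a 2)) + ip (w 1) (br (a 2) (a 0)) + ip (w 2) (br (a 0) (a 1)) := by
  refine fderiv_eq_of_expansion
    (M := ip (a 0) (br (w 1) (w 2)) + ip (a 1) (br (w 2) (w 0)) + ip (a 2) (br (w 0) (w 1)))
    (K := Phi w) ((contDiff_Phi (n := 1)).differentiable (by norm_num) a) fun t => ?_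
  simp [Phi, ip, br, cross_apply, dotProduct, Fin.sum_univ_three]
  ring

/-- The polarization of `frame`. -/
def framePolar (a b : Triple) : Fin 4 → Triple :=
  ![![br (a 1) (b 2), br (a 2) (b 0), br (a 0) (b 1)],
    ![0, br (a 1) (b 0), br (a 2) (b 0)],
    ![br (a 0) (b 1), 0, br (a 2) (b 1)],
    ![br (a 0) (b 2), br (a 1) (b 2), 0]]

theorem fderiv_frame (a w : Triple) (i : Fin 4) :
    fderiv ℝ (fun a => frame a i) a w = framePolar w a i + framePolar a w i := by
  refine fderiv_eq_of_expansion (M := frame w i) (K := 0)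
    ((contDiff_frame (n := 1) i).differentiable (by norm_num) a) fun t => ?_
  funext k
  fin_cases i <;> fin_cases k <;>
    simp [frame, framePolar, br_add_left, br_add_right, br_smul_left, br_smul_right] <;> module

/-! ### Brackets of the frame, as polynomial vector fields on `su(2)³`, and derivatives along it -/

theorem frame_bracket_zero (ha : a ∈ leaf q r) (k : Fin 3) :
    fderiv ℝ (fun a => frame a k.succ) a (frame a 0) -
      fderiv ℝ (fun a => frame a 0) a (frame a k.succ) =
        structureFun a k • frame a k.succ := by
  rw [fderiv_frame, fderiv_frame, frame_of_mem ha]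
  funext j
  fin_cases k <;> fin_cases j <;>
    simp [framePolar, br_smul_left, br_smul_right, br_neg_left, br_neg_right, br_self,
      br_zero_left, br_zero_right, br_one_two ha, br_two_zero ha, br_zero_one ha, br_two_one ha,
      br_zero_two ha, br_one_zero ha]

/-- For the curvature of `V₀, V₁` only the direction of this bracket matters: it must be orthogonal
to `V₀` and `V₁`. -/
theorem frame_bracket_one_two (ha : a ∈ leaf q r) :
    fderiv ℝ (fun a => frame a 2) a (frame a 1) - fderiv ℝ (fun a => frame a 1) a (frame a 2) =
        -structureFun a 2 • frame a 3 := by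
  rw [fderiv_frame, fderiv_frame, frame_of_mem ha]
  funext j
  fin_cases j <;>
    simp [framePolar, br_smul_left, br_smul_right, br_neg_left, br_neg_right, br_self,
      br_zero_left, br_zero_right, br_one_two ha, br_two_zero ha, br_zero_one ha, br_two_one ha,
      br_zero_two ha, br_one_zero ha]

theorem frame_bracket_one_three (ha : a ∈ leaf q r) :
    fderiv ℝ (fun a => frame a 3) a (frame a 1) - fderiv ℝ (fun a => frame a 1) a (frame a 3) =
        structureFun a 1 • frame a 2 := by
  rw [fderiv_frame, fderiv_frame, frame_of_mem ha]
  funext j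
  fin_cases j <;>
    simp [framePolar, br_smul_left, br_smul_right, br_neg_left, br_neg_right, br_self,
      br_zero_left, br_zero_right, br_one_two ha, br_two_zero ha, br_zero_one ha, br_two_one ha,
      br_zero_two ha, br_one_zero ha]

/-- The gradient of `Φ` for `ip3` is `V₀` itself, which is orthogonal to the other `V_i` and
satisfies `|V₀|² = Σ s_k² |a k|² = Φ Σ s_k`. -/
theorem fderiv_Phi_frame (ha : a ∈ leaf q r) (i : Fin 4) :
    fderiv ℝ Phi a (frame a i) =
      if i = 0 then Phi a * (structureFun a 0 + structureFun a 1 + structureFun a 2) else 0 := by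
  rw [fderiv_Phi, frame_of_mem ha, br_one_two ha, br_two_zero ha, br_zero_one ha]
  have h0 := structureFun_mul ha 0
  have h1 := structureFun_mul ha 1
  have h2 := structureFun_mul ha 2
  have ho := ha.2.1
  fin_cases i <;>
    simp [ip_smul_left, ip_smul_right, ip_neg_left, ip_zero_left, ho 0 1, ho 0 2, ho 1 2, ho 1 0,
      ho 2 0, ho 2 1, h0, h1, h2]
  ring

/-- Along `V₀` every `|a k|²` changes at the same rate `2Φ`; the rest is the quotient rule. -/
theorem fderiv_structureFun (ha : a ∈ leaf q r) (k : Fin 3) :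
    fderiv ℝ (fun a => structureFun a k) a (frame a 0) =
      structureFun a k * (structureFun a 0 + structureFun a 1 + structureFun a 2) -
        2 * structureFun a k ^ 2 := by
  have hk := (ip_self_pos_of_mem ha k).ne'
  have h1 : DifferentiableAt ℝ Phi a := (contDiff_Phi (n := 1)).differentiable (by norm_num) a
  have h2 : DifferentiableAt ℝ (fun a : Triple => ip (a k) (a k)) a :=
    (contDiff_ip_apply (n := 1) k k).differentiable (by norm_num) a
  have h3 : fderiv ℝ (fun a : Triple => ip (a k) (a k)) a (frame a 0) = 2 * Phi a := by
    rw [fderiv_ip_apply, frame_of_mem ha, ← structureFun_mul ha k]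
    fin_cases k <;> simp [ip_smul_left, ip_smul_right] <;> ring
  have h4 := h1.hasFDerivAt.mul (hasFDerivAt_inv hk |>.comp a h2.hasFDerivAt)
  have h5 : (fun a => structureFun a k) = Phi * (Inv.inv ∘ fun a : Triple => ip (a k) (a k)) := by
    funext a; simp [structureFun, div_eq_mul_inv]
  rw [h5, h4.fderiv]
  simp [h3, fderiv_Phi_frame ha]
  simp only [structureFun]
  field_simp
  ring

end

section

theorem two_le_infty : (2 : WithTop ℕ∞) ≤ ∞ :=
  WithTop.coe_le_coe.2 (le_top : (2 : ℕ∞) ≤ ⊤)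

/-! ### The frame in a local parametrization -/

theorem contDiffOn_ip3 {n : WithTop ℕ∞} {s : Set E4} {f g : E4 → Triple}
    (hf : ContDiffOn ℝ n f s) (hg : ContDiffOn ℝ n g s) :
    ContDiffOn ℝ n (fun y => ip3 (f y) (g y)) s := by
  simp only [ip3, ip, dotProduct]
  exact ContDiffOn.sum fun i _ => ContDiffOn.sum fun j _ =>
    (contDiffOn_pi.1 (contDiffOn_pi.1 hf i) j).mul (contDiffOn_pi.1 (contDiffOn_pi.1 hg i) j)

/-- The components of `dψ` in the frame. -/
def frameMatrix (ψ : E4 → Triple) (y : E4) : E4 →L[ℝ] E4 :=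
  ContinuousLinearMap.pi fun i => frameCoord (ψ y) i ∘L fderiv ℝ ψ y

theorem frameMatrix_apply (ψ : E4 → Triple) (y u : E4) (i : Fin 4) :
    frameMatrix ψ y u i = frameCoord (ψ y) i (fderiv ℝ ψ y u) := rfl

/-- The frame of the leaves, in the coordinates of a local parametrization `ψ`. -/
def paramFrame (ψ : E4 → Triple) (i : Fin 4) (y : E4) : E4 :=
  (frameMatrix ψ y).inverse (Pi.single i 1)

theorem leafMetricIn_apply (ψ : E4 → Triple) (y u v : E4) :
    leafMetricIn ψ y u v = -Phi (ψ y) * ∑ i, frameMatrix ψ y u i * frameMatrix ψ y v i := by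
  simp [leafMetricIn, leafMetric, frameMatrix_apply]

namespace IsLocalParam

variable {q r : ℝ} {Ω : Set E4} {ψ : E4 → Triple} {y : E4}

theorem mem_leaf {N : Set Triple} (h : IsLocalParam N Ω ψ) (hy : y ∈ Ω) : ψ y ∈ N := by
  obtain ⟨V, -, hV⟩ := h.image
  exact (hV ▸ mem_image_of_mem ψ hy : ψ y ∈ V ∩ N).2

theorem contDiffAt {N : Set Triple} (h : IsLocalParam N Ω ψ) (hy : y ∈ Ω) :
    ContDiffAt ℝ ∞ ψ y :=
  h.smooth.contDiffAt (h.isOpen.mem_nhds hy)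

theorem differentiableAt {N : Set Triple} (h : IsLocalParam N Ω ψ) (hy : y ∈ Ω) :
    DifferentiableAt ℝ ψ y :=
  (h.contDiffAt hy).differentiableAt (by simp)

theorem fderiv_comp_of_const {N : Set Triple} (h : IsLocalParam N Ω ψ) (hy : y ∈ Ω)
    {f : Triple → ℝ} (hf : DifferentiableAt ℝ f (ψ y)) {c : ℝ} (hc : ∀ a ∈ N, f a = c) (u : E4) :
    fderiv ℝ f (ψ y) (fderiv ℝ ψ y u) = 0 := by
  have h1 := hf.hasFDerivAt.comp y (h.differentiableAt hy).hasFDerivAt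
  have h2 : f ∘ ψ =ᶠ[𝓝 y] fun _ => c :=
    (h.isOpen.eventually_mem hy).mono fun z hz => hc _ (h.mem_leaf hz)
  have h3 := h1.unique ((hasFDerivAt_const c y).congr_of_eventuallyEq h2)
  exact congrArg (fun L => L u) h3

theorem isTangent_fderiv (h : IsLocalParam (leaf q r) Ω ψ) (hy : y ∈ Ω) (u : E4) :
    IsTangent (ψ y) (fderiv ℝ ψ y u) := by
  have hd : ∀ i j, DifferentiableAt ℝ (fun a : Triple => ip (a i) (a j)) (ψ y) := fun i j =>
    (contDiff_ip_apply (n := 1) i j).differentiable (by norm_num) _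
  refine ⟨fun i j hij => ?_, ?_, ?_⟩
  · rw [← fderiv_ip_apply]
    exact h.fderiv_comp_of_const hy (hd i j) (fun a ha => ha.2.1 i j hij) u
  · have := h.fderiv_comp_of_const hy ((hd 0 0).sub (hd 1 1)) (c := q)
      (fun a ha => ha.2.2.1) u
    rw [fderiv_sub (hd 0 0) (hd 1 1), sub_apply, fderiv_ip_apply, fderiv_ip_apply,
      ip_comm (ψ y _), ip_comm (ψ y _)] at this
    linarith
  · have := h.fderiv_comp_of_const hy ((hd 1 1).sub (hd 2 2)) (c := r)
      (fun a ha => ha.2.2.2) u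
    rw [fderiv_sub (hd 1 1) (hd 2 2), sub_apply, fderiv_ip_apply, fderiv_ip_apply,
      ip_comm (ψ y _), ip_comm (ψ y _)] at this
    linarith

theorem fderiv_eq_sum (h : IsLocalParam (leaf q r) Ω ψ) (hy : y ∈ Ω) (u : E4) :
    fderiv ℝ ψ y u = ∑ i, frameMatrix ψ y u i • frame (ψ y) i :=
  (h.isTangent_fderiv hy u).eq_sum (h.mem_leaf hy)

theorem frameMatrix_injective (h : IsLocalParam (leaf q r) Ω ψ) (hy : y ∈ Ω) :
    Function.Injective (frameMatrix ψ y) := by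
  rw [injective_iff_map_eq_zero]
  intro u hu
  refine h.immersion y hy ?_
  rw [h.fderiv_eq_sum hy, hu, map_zero]
  simp

theorem isInvertible_frameMatrix (h : IsLocalParam (leaf q r) Ω ψ) (hy : y ∈ Ω) :
    (frameMatrix ψ y).IsInvertible :=
  ⟨(LinearEquiv.ofInjectiveEndo (frameMatrix ψ y).toLinearMap
    (h.frameMatrix_injective hy)).toContinuousLinearEquiv, by ext; rfl⟩

theorem frameMatrix_paramFrame (h : IsLocalParam (leaf q r) Ω ψ) (hy : y ∈ Ω) (i : Fin 4) :
    frameMatrix ψ y (paramFrame ψ i y) = Pi.single i 1 :=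
  (h.isInvertible_frameMatrix hy).self_apply_inverse _

theorem fderiv_paramFrame (h : IsLocalParam (leaf q r) Ω ψ) (hy : y ∈ Ω) (i : Fin 4) :
    fderiv ℝ ψ y (paramFrame ψ i y) = frame (ψ y) i := by
  rw [h.fderiv_eq_sum hy, h.frameMatrix_paramFrame hy]
  simp [Pi.single_apply]

theorem contDiffOn_fderiv (h : IsLocalParam (leaf q r) Ω ψ) : ContDiffOn ℝ ∞ (fderiv ℝ ψ) Ω :=
  h.smooth.fderiv_of_isOpen h.isOpen (by simp)

theorem contDiffOn_frameMatrix (h : IsLocalParam (leaf q r) Ω ψ) :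
    ContDiffOn ℝ ∞ (frameMatrix ψ) Ω := by
  rw [contDiffOn_clm_apply]
  intro u
  rw [contDiffOn_pi]
  intro i
  simp only [frameMatrix_apply, frameCoord_apply]
  have hf : ContDiffOn ℝ ∞ (fun y => frame (ψ y) i) Ω :=
    (contDiff_frame i).comp_contDiffOn h.smooth
  exact (contDiffOn_ip3 (contDiffOn_clm_apply.1 h.contDiffOn_fderiv u) hf).div
    (contDiffOn_ip3 hf hf) fun y hy => ip3_frame_self_ne_zero (h.mem_leaf hy) i

theorem contDiffAt_paramFrame (h : IsLocalParam (leaf q r) Ω ψ) (hy : y ∈ Ω) (i : Fin 4) :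
    ContDiffAt ℝ ∞ (paramFrame ψ i) y := by
  have h1 := h.contDiffOn_frameMatrix.contDiffAt (h.isOpen.mem_nhds hy)
  have h2 : ContDiffAt ℝ ∞ (fun y => (frameMatrix ψ y).inverse) y :=
    (h.isInvertible_frameMatrix hy).contDiffAt_map_inverse.comp y h1
  exact h2.clm_apply contDiffAt_const

theorem contDiffAt_leafMetricIn (h : IsLocalParam (leaf q r) Ω ψ) (hy : y ∈ Ω) :
    ContDiffAt ℝ ∞ (leafMetricIn ψ) y := by
  suffices ContDiffOn ℝ ∞ (leafMetricIn ψ) Ω from this.contDiffAt (h.isOpen.mem_nhds hy)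
  rw [contDiffOn_clm_apply]
  intro u
  rw [contDiffOn_clm_apply]
  intro v
  simp only [leafMetricIn_apply]
  have hC : ∀ (u : E4) i, ContDiffOn ℝ ∞ (fun y => frameMatrix ψ y u i) Ω := fun u i =>
    contDiffOn_pi.1 (contDiffOn_clm_apply.1 h.contDiffOn_frameMatrix u) i
  exact (contDiff_Phi.comp_contDiffOn h.smooth).neg.mul
    (ContDiffOn.sum fun i _ => (hC u i).mul (hC v i))

theorem leafMetricIn_pos (h : IsLocalParam (leaf q r) Ω ψ) (hy : y ∈ Ω) (u : E4) (hu : u ≠ 0) :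
    0 < leafMetricIn ψ y u u := by
  rw [leafMetricIn_apply]
  refine mul_pos (neg_pos.2 (h.mem_leaf hy).1) ?_
  have h0 : frameMatrix ψ y u ≠ 0 := fun h0 =>
    hu (h.frameMatrix_injective hy (h0.trans (map_zero _).symm))
  obtain ⟨i, hi⟩ := Function.ne_iff.1 h0
  exact Finset.sum_pos' (fun i _ => mul_self_nonneg _)
    ⟨i, Finset.mem_univ i, mul_self_pos.2 hi⟩

theorem leafMetricIn_paramFrame (h : IsLocalParam (leaf q r) Ω ψ) (hy : y ∈ Ω) (u : E4)
    (i : Fin 4) :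
    leafMetricIn ψ y u (paramFrame ψ i y) = -Phi (ψ y) * frameMatrix ψ y u i := by
  rw [leafMetricIn_apply, h.frameMatrix_paramFrame hy]
  simp [Pi.single_apply]

/-- Brackets of `ψ`-related fields are `ψ`-related: differentiate `dψ(paramFrame) = frame ∘ ψ` and
use the symmetry of the second derivative of `ψ`. -/
theorem fderiv_lieBracket_paramFrame (h : IsLocalParam (leaf q r) Ω ψ) (hy : y ∈ Ω)
    (i j : Fin 4) :
    fderiv ℝ ψ y (VectorField.lieBracket ℝ (paramFrame ψ i) (paramFrame ψ j) y) =
      fderiv ℝ (fun a => frame a j) (ψ y) (frame (ψ y) i) -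
        fderiv ℝ (fun a => frame a i) (ψ y) (frame (ψ y) j) := by
  have key : ∀ k (u : E4), fderiv ℝ (fderiv ℝ ψ) y u (paramFrame ψ k y) +
      fderiv ℝ ψ y (fderiv ℝ (paramFrame ψ k) y u) =
        fderiv ℝ (fun a => frame a k) (ψ y) (fderiv ℝ ψ y u) := by
    intro k u
    have h1 : DifferentiableAt ℝ (fderiv ℝ ψ) y :=
      (h.contDiffOn_fderiv.contDiffAt (h.isOpen.mem_nhds hy)).differentiableAt (by simp)
    have h2 : DifferentiableAt ℝ (paramFrame ψ k) y :=
      (h.contDiffAt_paramFrame hy k).differentiableAt (by simp)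
    have h3 := h1.hasFDerivAt.clm_apply h2.hasFDerivAt
    have h4 : DifferentiableAt ℝ (fun a => frame a k) (ψ y) :=
      (contDiff_frame (n := 1) k).differentiable (by norm_num) _
    have h5 := h4.hasFDerivAt.comp y (h.differentiableAt hy).hasFDerivAt
    have h6 := h3.unique (h5.congr_of_eventuallyEq
      ((h.isOpen.eventually_mem hy).mono fun z hz => h.fderiv_paramFrame hz k))
    have h7 := congrArg (fun L => L u) h6
    simp only [add_apply, ContinuousLinearMap.comp_apply, ContinuousLinearMap.flip_apply] at h7
    rw [← h7, add_comm]
  have hs : fderiv ℝ (fderiv ℝ ψ) y (paramFrame ψ i y) (paramFrame ψ j y) =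
      fderiv ℝ (fderiv ℝ ψ) y (paramFrame ψ j y) (paramFrame ψ i y) :=
    (((h.contDiffAt hy).of_le (m := 2) two_le_infty).isSymmSndFDerivAt
      (by simp)).eq _ _
  rw [← h.fderiv_paramFrame hy i, ← h.fderiv_paramFrame hy j, ← key, ← key,
    VectorField.lieBracket, map_sub, hs]
  abel

/-- The numerator of the sectional curvature in the frame. -/
theorem leafMetricIn_curvature (h : IsLocalParam (leaf q r) Ω ψ) (hy : y ∈ Ω) :
    leafMetricIn ψ y (curvature (leafMetricIn ψ) y (paramFrame ψ 0 y) (paramFrame ψ 1 y)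
        (paramFrame ψ 1 y)) (paramFrame ψ 0 y) =
      -Phi (ψ y) * (1 / 2 * ((structureFun (ψ y) 0 + structureFun (ψ y) 1 + structureFun (ψ y) 2)
          * (structureFun (ψ y) 0 - structureFun (ψ y) 1 - structureFun (ψ y) 2)
        - 2 * (structureFun (ψ y) 0 ^ 2 - structureFun (ψ y) 1 ^ 2 - structureFun (ψ y) 2 ^ 2)
        - structureFun (ψ y) 0 *
          (structureFun (ψ y) 0 - structureFun (ψ y) 1 - structureFun (ψ y) 2))) := by
  have hle : (2 : WithTop ℕ∞) ≤ ∞ := two_le_infty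
  have hinj := fun z (hz : z ∈ Ω) => h.immersion z hz
  have hdS : ∀ k, DifferentiableAt ℝ (fun a => structureFun a k) (ψ y) := fun k =>
    ((contDiff_Phi (n := 1)).contDiffAt.div (contDiff_ip_apply k k).contDiffAt
      (ip_self_pos_of_mem (h.mem_leaf hy) k).ne').differentiableAt (by norm_num)
  have hdSψ : ∀ k, HasFDerivAt (fun z => structureFun (ψ z) k)
      (fderiv ℝ (fun a => structureFun a k) (ψ y) ∘L fderiv ℝ ψ y) y := fun k =>
    (hdS k).hasFDerivAt.comp y (h.differentiableAt hy).hasFDerivAt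
  have hdP : ∀ z ∈ Ω, HasFDerivAt (fun z => -Phi (ψ z)) (-(fderiv ℝ Phi (ψ z) ∘L fderiv ℝ ψ z)) z :=
    fun z hz => (((contDiff_Phi (n := 1)).differentiable (by norm_num) _).hasFDerivAt.comp z
      (h.differentiableAt hz).hasFDerivAt).neg
  have hα := (((hdSψ 0).sub (hdSψ 1)).sub (hdSψ 2)).const_mul (1 / 2 : ℝ)
  have hm := h.mem_leaf hy
  have key := metric_curvature_of_frame (G := leafMetricIn ψ) (x := y) h.isOpen
    (fun z hz => (h.contDiffAt_leafMetricIn hz).of_le hle)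
    (fun z hz u v => by simp only [leafMetricIn_apply, mul_comm])
    (fun z hz => isInvertible_of_pos (h.leafMetricIn_pos hz))
    (W := paramFrame ψ) (fun z hz i => (h.contDiffAt_paramFrame hz i).of_le hle)
    (ρ := fun z => -Phi (ψ z))
    (D := fun z => -Phi (ψ z) *
      (structureFun (ψ z) 0 + structureFun (ψ z) 1 + structureFun (ψ z) 2))
    (α := fun z => 1 / 2 * (structureFun (ψ z) 0 - structureFun (ψ z) 1 - structureFun (ψ z) 2))
    (b := ![0, fun z => structureFun (ψ z) 0, fun z => structureFun (ψ z) 1,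
      fun z => structureFun (ψ z) 2])
    (m := fun z => -structureFun (ψ z) 2) (n := fun z => structureFun (ψ z) 1)
    (fun z hz i j => by
      rw [h.leafMetricIn_paramFrame hz, h.frameMatrix_paramFrame hz]
      simp [Pi.single_apply, eq_comm])
    (fun z hz v hv => h.frameMatrix_injective hz (by
      rw [map_zero]
      funext i
      have := hv i
      rw [h.leafMetricIn_paramFrame hz] at this
      exact (mul_eq_zero.1 this).resolve_left (neg_ne_zero.2 (h.mem_leaf hz).1.ne)))
    (fun z hz => neg_ne_zero.2 (h.mem_leaf hz).1.ne)
    (fun z hz i => by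
      rw [(hdP z hz).fderiv]
      simp only [neg_apply, ContinuousLinearMap.comp_apply, h.fderiv_paramFrame hz,
        fderiv_Phi_frame (h.mem_leaf hz)]
      split_ifs <;> simp)
    (fun z hz i hi => hinj z hz (by
      obtain ⟨k, rfl⟩ := Fin.exists_succ_eq.2 hi
      rw [h.fderiv_lieBracket_paramFrame hz, frame_bracket_zero (h.mem_leaf hz), map_smul,
        h.fderiv_paramFrame hz]
      fin_cases k <;> rfl))
    (fun z hz => hinj z hz (by
      rw [h.fderiv_lieBracket_paramFrame hz, frame_bracket_one_two (h.mem_leaf hz), map_smul,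
        h.fderiv_paramFrame hz]))
    (fun z hz => hinj z hz (by
      rw [h.fderiv_lieBracket_paramFrame hz, frame_bracket_one_three (h.mem_leaf hz), map_smul,
        h.fderiv_paramFrame hz]))
    (fun z hz => by
      have := (h.mem_leaf hz).1.ne
      simp
      field_simp
      ring)
    hy hα.differentiableAt
    ((hdP y hy).differentiableAt.mul
      (((hdSψ 0).add (hdSψ 1)).add (hdSψ 2)).differentiableAt)
    (hdP y hy).differentiableAt
  rw [key]
  have hα' := hα.fderiv
  simp only [Pi.sub_apply] at hα'
  have e : fderiv ℝ (fun z => 1 / 2 *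
      (structureFun (ψ z) 0 - structureFun (ψ z) 1 - structureFun (ψ z) 2)) y = _ := hα'
  rw [e]
  simp only [smul_apply, sub_apply, ContinuousLinearMap.comp_apply, h.fderiv_paramFrame hy,
    fderiv_structureFun hm, smul_eq_mul]
  simp
  left
  ring

end IsLocalParam

/-- The sectional curvature of the leaves in the direction of `V₀, V₁`. -/
def frameCurvature (a : Triple) : ℝ :=
  (1 / 2 * ip (a 0) (a 0) ^ 2 * (ip (a 1) (a 1) - ip (a 2) (a 2)) ^ 2 +
    1 / 2 * ip (a 0) (a 0) * ip (a 1) (a 1) * ip (a 2) (a 2) * (ip (a 1) (a 1) + ip (a 2) (a 2)) -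
    ip (a 1) (a 1) ^ 2 * ip (a 2) (a 2) ^ 2) / (-Phi a) ^ 3

theorem IsLocalParam.sectionalCurvature_eq {q r : ℝ} {Ω : Set E4} {ψ : E4 → Triple} {y u v : E4}
    (h : IsLocalParam (leaf q r) Ω ψ) (hy : y ∈ Ω) (hu : fderiv ℝ ψ y u = frame (ψ y) 0)
    (hv : fderiv ℝ ψ y v = frame (ψ y) 1) :
    sectionalCurvature (leafMetricIn ψ) y u v = frameCurvature (ψ y) := by
  obtain rfl : u = paramFrame ψ 0 y :=
    h.immersion y hy (hu.trans (h.fderiv_paramFrame hy 0).symm)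
  obtain rfl : v = paramFrame ψ 1 y :=
    h.immersion y hy (hv.trans (h.fderiv_paramFrame hy 1).symm)
  have hm := h.mem_leaf hy
  have hP := hm.1.ne
  have hsq := Phi_sq hm
  have h0 := (ip_self_pos_of_mem hm 0).ne'
  have h1 := (ip_self_pos_of_mem hm 1).ne'
  have h2 := (ip_self_pos_of_mem hm 2).ne'
  rw [sectionalCurvature, h.leafMetricIn_curvature hy]
  simp only [h.leafMetricIn_paramFrame hy, h.frameMatrix_paramFrame hy]
  simp only [Pi.single_eq_same, ne_eq, zero_ne_one, not_false_eq_true,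
    Pi.single_eq_of_ne', mul_one, mul_zero, structureFun, frameCurvature]
  set P := Phi (ψ y)
  set A := ip (ψ y 0) (ψ y 0)
  set B := ip (ψ y 1) (ψ y 1)
  set C := ip (ψ y 2) (ψ y 2)
  -- The curvature in terms of the structure functions and `frameCurvature` agree only modulo `Φ² =
  -- ABC`.
  have hsq' : P ^ 6 = P ^ 2 * (A ^ 2 * B ^ 2 * C ^ 2) := by
    rw [show P ^ 6 = P ^ 2 * (P ^ 2) ^ 2 by ring, hsq]; ring
  field_simp
  ring_nf
  rw [hsq']
  ring

end

section

/-! ### Existence of local parametrizations -/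

/-- The left hand sides of the equations of the leaves. -/
def leafEquations (a : Triple) : Fin 5 → ℝ :=
  ![ip (a 0) (a 1), ip (a 0) (a 2), ip (a 1) (a 2), ip (a 0) (a 0) - ip (a 1) (a 1),
    ip (a 1) (a 1) - ip (a 2) (a 2)]

/-- A map that straightens the leaves near `a`. -/
def straighten (a b : Triple) : E4 × (Fin 5 → ℝ) :=
  (fun i => ip3 b (frame a i), leafEquations b)

variable {q r : ℝ} {a : Triple}

theorem mem_leaf_iff : a ∈ leaf q r ↔ Phi a < 0 ∧ leafEquations a = ![0, 0, 0, q, r] := by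
  constructor
  · rintro ⟨h, ho, h1, h2⟩
    refine ⟨h, ?_⟩
    simp only [leafEquations, ho 0 1 (by decide), ho 0 2 (by decide), ho 1 2 (by decide), h1, h2]
  · rintro ⟨h, he⟩
    have e := congrFun he
    have e0 := e 0
    have e1 := e 1
    have e2 := e 2
    have e3 := e 3
    have e4 := e 4
    simp [leafEquations] at e0 e1 e2 e3 e4
    refine ⟨h, fun i j hij => ?_, e3, e4⟩
    fin_cases i <;> fin_cases j <;>
      first | exact absurd rfl hij | assumption | (rw [ip_comm]; assumption)

theorem contDiff_straighten (a : Triple) : ContDiff ℝ ∞ (straighten a) := by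
  refine ContDiff.prodMk ?_ ?_
  · rw [contDiff_pi]
    intro i
    simp only [ip3, ip, dotProduct]
    fun_prop
  · rw [contDiff_pi]
    intro i
    fin_cases i
    · exact contDiff_ip_apply 0 1
    · exact contDiff_ip_apply 0 2
    · exact contDiff_ip_apply 1 2
    · exact (contDiff_ip_apply 0 0).sub (contDiff_ip_apply 1 1)
    · exact (contDiff_ip_apply 1 1).sub (contDiff_ip_apply 2 2)

theorem fderiv_straighten (a b w : Triple) :
    fderiv ℝ (straighten a) b w =
      (fun i => ip3 w (frame a i),
        ![ip (w 0) (b 1) + ip (b 0) (w 1), ip (w 0) (b 2) + ip (b 0) (w 2),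
          ip (w 1) (b 2) + ip (b 1) (w 2), 2 * ip (w 0) (b 0) - 2 * ip (w 1) (b 1),
          2 * ip (w 1) (b 1) - 2 * ip (w 2) (b 2)]) := by
  refine fderiv_eq_of_expansion (M := (0, leafEquations w)) (K := 0)
    ((contDiff_straighten a).differentiable (by simp) b) fun t => ?_
  refine Prod.ext (funext fun i => ?_) (funext fun i => ?_)
  · simp [straighten, ip3_add_left, ip3_smul_left]
  · fin_cases i <;>
      simp [straighten, leafEquations, ip_add_left, ip_add_right, ip_smul_left, ip_smul_right]
        <;> simp only [ip_comm (b _) (w _)] <;> ring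

/-- The kernel consists of the tangent vectors orthogonal to the frame, so it vanishes by
`IsTangent.eq_zero`; both sides have dimension `9 = 4 + 5`. -/
theorem exists_fderiv_straighten (ha : a ∈ leaf q r) :
    ∃ e : Triple ≃L[ℝ] E4 × (Fin 5 → ℝ),
      (e : Triple →L[ℝ] E4 × (Fin 5 → ℝ)) = fderiv ℝ (straighten a) a := by
  have hinj : Function.Injective (fderiv ℝ (straighten a) a) := by
    rw [injective_iff_map_eq_zero]
    intro w hw
    rw [fderiv_straighten, Prod.mk_eq_zero] at hw
    have h1 := congrFun hw.1
    have e := congrFun hw.2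
    have e0 := e 0
    have e1 := e 1
    have e2 := e 2
    have e3 := e 3
    have e4 := e 4
    simp at e0 e1 e2 e3 e4
    have hcomm : ∀ i j, ip (w i) (a j) + ip (a i) (w j) = ip (w j) (a i) + ip (a j) (w i) := by
      intro i j
      rw [ip_comm (w i), ip_comm (a i), add_comm]
    refine IsTangent.eq_zero ha ⟨fun i j hij => ?_, by linarith, by linarith⟩ h1
    fin_cases i <;> fin_cases j <;>
      first | exact absurd rfl hij | assumption | exact (hcomm _ _).trans (by assumption)
  refine ⟨(LinearEquiv.ofInjectiveOfFinrankEq (fderiv ℝ (straighten a) a).toLinearMap hinj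
    ?_).toContinuousLinearEquiv, by ext <;> rfl⟩
  simp [Module.finrank_pi_fintype ℝ (M := fun _ : Fin 3 => Su2)]

/-- By the inverse function theorem `straighten a` is a local diffeomorphism under which the leaf
becomes the slice with second component `c`; `ψ` is the inverse on that slice. -/
theorem exists_isLocalParam (ha : a ∈ leaf q r) :
    ∃ (Ω : Set E4) (ψ : E4 → Triple), IsLocalParam (leaf q r) Ω ψ ∧ ∃ x ∈ Ω, ψ x = a := by
  obtain ⟨e, he⟩ := exists_fderiv_straighten ha
  set H := straighten a
  have hH : ContDiff ℝ ∞ H := contDiff_straighten a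
  have hd : Differentiable ℝ H := hH.differentiable (by simp)
  have hs : HasStrictFDerivAt H (e : Triple →L[ℝ] E4 × (Fin 5 → ℝ)) a := by
    rw [he]
    exact hH.contDiffAt.hasStrictFDerivAt (by simp)
  set f := hs.toOpenPartialHomeomorph H
  have hfa : a ∈ f.source := hs.mem_toOpenPartialHomeomorph_source
  -- Shrinking to this set makes the inverse smooth at every point of the target and keeps the sign
  -- of `Φ` on the slice.
  have hU : IsOpen {b | Phi b < 0 ∧ (fderiv ℝ H b).IsInvertible} := by
    refine (isOpen_Iio.preimage (contDiff_Phi (n := 0)).continuous).inter ?_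
    exact (ContinuousLinearEquiv.isOpen (𝕜 := ℝ)).preimage (hH.continuous_fderiv (by simp))
  set f' := f.restrOpen _ hU
  have hf'a : a ∈ f'.source := ⟨hfa, ha.1, e, he⟩
  have hf' : ∀ b, f' b = H b := fun b => rfl
  set c : Fin 5 → ℝ := ![0, 0, 0, q, r]
  have hc : ∀ y, ((y, c) : E4 × (Fin 5 → ℝ)) ∈ f'.target →
      f'.symm (y, c) ∈ f'.source ∧ H (f'.symm (y, c)) = (y, c) := fun y hy =>
    ⟨f'.map_target hy, f'.right_inv hy⟩
  have hsym : ∀ z ∈ f'.target, ContDiffAt ℝ ∞ f'.symm z := by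
    intro z hz
    obtain ⟨e', he'⟩ := (f'.map_target hz).2.2
    exact f'.contDiffAt_symm hz (he' ▸ (hd _).hasFDerivAt) hH.contDiffAt
  have hmk : ContDiff ℝ ∞ fun y : E4 => ((y, c) : E4 × (Fin 5 → ℝ)) := by fun_prop
  have hψ : ∀ y, ((y, c) : E4 × (Fin 5 → ℝ)) ∈ f'.target →
      ContDiffAt ℝ ∞ (fun y : E4 => f'.symm (y, c)) y := fun y hy =>
    (hsym _ hy).comp y hmk.contDiffAt
  refine ⟨{y | (y, c) ∈ f'.target}, fun y => f'.symm (y, c), ⟨?_, ?_, ?_, ?_, ?_⟩, (H a).1, ?_, ?_⟩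
  · exact f'.open_target.preimage hmk.continuous
  · exact fun y hy => (hψ y hy).contDiffWithinAt
  · intro y hy
    have h1 : (fun z => (H (f'.symm (z, c))).1) =ᶠ[𝓝 y] fun z => z :=
      ((f'.open_target.preimage hmk.continuous).eventually_mem hy).mono fun z hz => by
        change (H (f'.symm (z, c))).1 = z
        rw [(hc z hz).2]
    have h2 : HasFDerivAt (fun z => (H (f'.symm (z, c))).1) _ y :=
      ((hd _).hasFDerivAt.comp y ((hψ y hy).differentiableAt (by simp)).hasFDerivAt).fst
    have h3 := h2.unique ((hasFDerivAt_id y).congr_of_eventuallyEq h1)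
    refine Function.LeftInverse.injective
      (g := fun w => (fderiv ℝ H (f'.symm (y, c)) w).1) fun w => ?_
    exact congrArg (fun L => L w) h3
  -- The continuous map `b ↦ (H b).1` is a left inverse of `ψ`; its derivative has just given
  -- injectivity of `dψ`.
  · refine Topology.IsEmbedding.of_comp (g := fun b => (H b).1) ?_ (by
      have := hH.continuous
      fun_prop) ?_
    · exact continuousOn_iff_continuous_domRestrict.1
        fun y hy => (hψ y hy).continuousAt.continuousWithinAt
    · have hval : (fun b => (H b).1) ∘ domRestrict {y | (y, c) ∈ f'.target}
          (fun y => f'.symm (y, c)) = Subtype.val := by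
        funext y
        change (H (f'.symm (y.1, c))).1 = y.1
        rw [(hc y.1 y.2).2]
      rw [hval]
      exact Topology.IsEmbedding.subtypeVal
  · refine ⟨f'.source, f'.open_source, ?_⟩
    ext b
    constructor
    · rintro ⟨y, hy, rfl⟩
      exact ⟨(hc y hy).1, mem_leaf_iff.2 ⟨(hc y hy).1.2.1, congrArg Prod.snd (hc y hy).2⟩⟩
    · rintro ⟨hb, hbl⟩
      have h1 : ((H b).1, c) = f' b := by
        rw [hf']
        exact Prod.ext rfl (mem_leaf_iff.1 hbl).2.symm
      refine ⟨(H b).1, ?_, ?_⟩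
      · change _ ∈ f'.target
        rw [h1]
        exact f'.map_source hb
      · change f'.symm _ = b
        rw [h1]
        exact f'.left_inv hb
  · change ((H a).1, c) ∈ f'.target
    rw [show ((H a).1, c) = f' a from Prod.ext rfl (mem_leaf_iff.1 ha).2.symm]
    exact f'.map_source hf'a
  · change f'.symm ((H a).1, c) = a
    rw [show ((H a).1, c) = f' a from Prod.ext rfl (mem_leaf_iff.1 ha).2.symm]
    exact f'.left_inv hf'a

/-- Some parametrization exists, so the chosen value comes from one, and the formula is the same in
all of them. -/
theorem leafSectionalCurvature_frame (ha : a ∈ leaf q r) :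
    leafSectionalCurvature q r a (frame a 0) (frame a 1) = frameCurvature a := by
  have h : ∃ k, HasSectionalCurvature q r a (frame a 0) (frame a 1) k := by
    obtain ⟨Ω, ψ, h, x, hx, rfl⟩ := exists_isLocalParam ha
    exact ⟨_, Ω, ψ, x, paramFrame ψ 0 x, paramFrame ψ 1 x, h, hx, rfl,
      h.fderiv_paramFrame hx 0, h.fderiv_paramFrame hx 1, rfl⟩
  obtain ⟨Ω, ψ, x, u, v, h, hx, hxa, hu, hv, hk⟩ := Classical.epsilon_spec h
  rw [leafSectionalCurvature, ← hk, ← hxa]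
  exact h.sectionalCurvature_eq hx (hxa ▸ hu) (hxa ▸ hv)

/-! ### Behaviour of the curvature at the boundary -/

/-- The leaf equations, `Φ ≤ 0` and `Phi_sq` are closed conditions. A limit point with `Φ ≠ 0` would
lie in the leaf, so some `a k` vanishes; `q ≥ 0` and `r > 0` leave only `a 2`. -/
theorem boundary_point (hr : 0 < r) (hq : 0 ≤ q) {p : Triple}
    (hp : p ∈ closure (leaf q r) \ leaf q r) :
    Phi p = 0 ∧ ip (p 0) (p 0) = q + r ∧ ip (p 1) (p 1) = r ∧ ip (p 2) (p 2) = 0 := by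
  have cip : ∀ i j, Continuous fun a : Triple => ip (a i) (a j) := fun i j =>
    (contDiff_ip_apply (n := 0) i j).continuous
  have cP : Continuous Phi := (contDiff_Phi (n := 0)).continuous
  have hcl : closure (leaf q r) ⊆ {a | Phi a ≤ 0 ∧ leafEquations a = ![0, 0, 0, q, r] ∧
      Phi a ^ 2 = ip (a 0) (a 0) * ip (a 1) (a 1) * ip (a 2) (a 2)} := by
    refine closure_minimal (fun a ha => ⟨ha.1.le, (mem_leaf_iff.1 ha).2, Phi_sq ha⟩) ?_
    refine (isClosed_le cP continuous_const).inter ((isClosed_eq ?_ continuous_const).inter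
      (isClosed_eq (cP.pow 2) (((cip 0 0).mul (cip 1 1)).mul (cip 2 2))))
    exact continuous_snd.comp (contDiff_straighten 0).continuous
  obtain ⟨h1, h2, h3⟩ := hcl hp.1
  have hP : Phi p = 0 := by
    by_contra h0
    exact hp.2 (mem_leaf_iff.2 ⟨lt_of_le_of_ne h1 h0, h2⟩)
  have e3 := congrFun h2 3
  have e4 := congrFun h2 4
  simp [leafEquations] at e3 e4
  have hn := ip_self_nonneg (p 2)
  have hz : ip (p 2) (p 2) = 0 := by
    rw [hP, zero_pow two_ne_zero, eq_comm, mul_eq_zero, mul_eq_zero] at h3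
    rcases h3 with (h | h) | h
    · linarith
    · linarith
    · exact h
  exact ⟨hP, by linarith, by linarith, hz⟩

theorem tendsto_frameCurvature (hr : 0 < r) (hq : 0 ≤ q) {p : Triple}
    (hp : p ∈ closure (leaf q r) \ leaf q r) :
    Tendsto frameCurvature (𝓝[leaf q r] p) atTop := by
  obtain ⟨hP, h0, h1, h2⟩ := boundary_point hr hq hp
  have cip : ∀ i j, Continuous fun a : Triple => ip (a i) (a j) := fun i j =>
    (contDiff_ip_apply (n := 0) i j).continuous
  have c0 := cip 0 0
  have c1 := cip 1 1
  have c2 := cip 2 2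
  have cP : Continuous Phi := (contDiff_Phi (n := 0)).continuous
  set num : Triple → ℝ := fun a =>
    1 / 2 * ip (a 0) (a 0) ^ 2 * (ip (a 1) (a 1) - ip (a 2) (a 2)) ^ 2 +
    1 / 2 * ip (a 0) (a 0) * ip (a 1) (a 1) * ip (a 2) (a 2) * (ip (a 1) (a 1) + ip (a 2) (a 2)) -
    ip (a 1) (a 1) ^ 2 * ip (a 2) (a 2) ^ 2 with hnum
  have hn : Tendsto num (𝓝[leaf q r] p) (𝓝 (num p)) := by
    have : Continuous num := by fun_prop
    exact this.continuousAt.continuousWithinAt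
  -- The value is `(q + r)² r² / 2`.
  have hpos : 0 < num p := by
    simp only [hnum, h0, h1, h2]
    ring_nf
    positivity
  have hd : Tendsto (fun a => (-Phi a) ^ 3) (𝓝[leaf q r] p) (𝓝[>] 0) := by
    refine tendsto_nhdsWithin_iff.2 ⟨?_, ?_⟩
    · have : Continuous fun a => (-Phi a) ^ 3 := by fun_prop
      have h := this.continuousAt (x := p)
      simp only [ContinuousAt, hP] at h
      simpa using h.mono_left (nhdsWithin_le_nhds (s := leaf q r))
    · filter_upwards [self_mem_nhdsWithin] with a ha
      exact pow_pos (neg_pos.2 ha.1) 3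
  refine (hd.inv_tendsto_nhdsGT_zero.atTop_mul_pos hpos hn).congr fun a => ?_
  change ((-Phi a) ^ 3)⁻¹ * num a = num a / (-Phi a) ^ 3
  rw [mul_comm, div_eq_mul_inv]

/-! ### The hyperkähler structure does not extend -/

theorem metric_eq_leafMetricIn {S : Set E4} {ψ : E4 → Triple} {g : E4 → E4 →L[ℝ] E4 →L[ℝ] ℝ}
    (hg : ∀ x ∈ S, ∀ u v, g x u v = leafMetric (ψ x) (fderiv ℝ ψ x u) (fderiv ℝ ψ x v)) :
    EqOn g (leafMetricIn ψ) S := fun x hx => by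
  ext u v
  simp [leafMetricIn, hg x hx]

theorem sectionalCurvature_congr {G G' : E4 → E4 →L[ℝ] E4 →L[ℝ] ℝ} {x : E4} (h : G =ᶠ[𝓝 x] G')
    (u v : E4) : sectionalCurvature G x u v = sectionalCurvature G' x u v := by
  have h1 : ∀ u v w, curvature G x u v w = curvature G' x u v w := by
    intro u v w
    have h2 : ∀ᶠ y in 𝓝 x, G =ᶠ[𝓝 y] G' := h.eventually_nhds
    have h3 : ∀ X Y : E4 → E4, covDeriv G X Y =ᶠ[𝓝 x] covDeriv G' X Y := fun X Y =>
      h2.mono fun y hy => by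
        simp only [covDeriv, christoffel, hy.fderiv_eq, hy.eq_of_nhds]
    rw [curvature, curvature, covDeriv_congr rfl (h3 (fun _ => v) _), (h3 _ _).eq_of_nhds,
      covDeriv_congr rfl (h3 (fun _ => u) _), (h3 (fun _ => v) _).eq_of_nhds]
  rw [sectionalCurvature, sectionalCurvature, h1, h.eq_of_nhds]

theorem not_hyperkahlerExtendsTo (hr : 0 < r) (hq : 0 ≤ q) {p : Triple}
    (hp : p ∈ closure (leaf q r) \ leaf q r) : ¬ HyperkahlerExtendsTo q r p := by
  rintro ⟨U, S, ψ, hU, hpU, hψS, hemb, hparam, g, I, J, K, hk, hagree⟩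
  have hpS : p ∈ ψ '' S := hψS ▸ ⟨hpU, hp.1⟩
  obtain ⟨x₀, hx₀, rfl⟩ := hpS
  obtain ⟨C, hC⟩ := exists_curvature_bound ((hk.riemannian.smooth x₀ hx₀).of_le two_le_infty)
    (hk.riemannian.pos x₀ hx₀)
  obtain ⟨O, hO, hOo, hxO⟩ := mem_nhds_iff.1 hC
  -- `S` need not be open, so the neighbourhood `O` of `x₀` is carried to `su(2)³` through the
  -- embedding on `S`.
  obtain ⟨V, hV, hVO⟩ := hemb.isInducing.isOpen_iff.1 (hOo.preimage continuous_subtype_val :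
    IsOpen ((↑) ⁻¹' O : Set S))
  have hmem : ∀ x (hx : x ∈ S), ψ x ∈ V ↔ x ∈ O := fun x hx =>
    Set.ext_iff.1 hVO ⟨x, hx⟩
  have hne : (𝓝[leaf q r] ψ x₀).NeBot := mem_closure_iff_nhdsWithin_neBot.1 hp.1
  have hl : ∀ᶠ a in 𝓝[leaf q r] ψ x₀, a ∈ leaf q r := self_mem_nhdsWithin
  have hev : ∀ᶠ a in 𝓝[leaf q r] ψ x₀, C < frameCurvature a ∧ a ∈ leaf q r ∧ a ∈ V ∩ U :=
    ((tendsto_frameCurvature hr hq hp).eventually_gt_atTop C).and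
      (hl.and (mem_nhdsWithin_of_mem_nhds
        ((hV.inter hU).mem_nhds ⟨(hmem x₀ hx₀).2 hxO, hpU⟩)))
  obtain ⟨a, haC, hal, haV, haU⟩ := hev.exists
  obtain ⟨x, hx, rfl⟩ : a ∈ ψ '' S := hψS ▸ ⟨haU, subset_closure hal⟩
  have hxΩ : x ∈ S ∩ ψ ⁻¹' leaf q r := ⟨hx, hal⟩
  have hge : EqOn g (leafMetricIn ψ) (S ∩ ψ ⁻¹' leaf q r) :=
    metric_eq_leafMetricIn fun y hy u v => (hagree y hy u).1 v
  -- Over the leaf the coordinate domain is open, so the metrics agree as germs and have the same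
  -- curvature.
  have hgn : g =ᶠ[𝓝 x] leafMetricIn ψ :=
    (hparam.isOpen.eventually_mem hxΩ).mono fun y hy => hge hy
  have hsec := hparam.sectionalCurvature_eq hxΩ (hparam.fderiv_paramFrame hxΩ 0)
    (hparam.fderiv_paramFrame hxΩ 1)
  rw [← sectionalCurvature_congr hgn, sectionalCurvature] at hsec
  set u := paramFrame ψ 0 x
  set v := paramFrame ψ 1 x
  have huv : g x u v = 0 := by
    rw [hge hxΩ, hparam.leafMetricIn_paramFrame hxΩ, hparam.frameMatrix_paramFrame hxΩ]
    simp
  have hpos : ∀ i, 0 < g x (paramFrame ψ i x) (paramFrame ψ i x) := fun i => by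
    rw [hge hxΩ, hparam.leafMetricIn_paramFrame hxΩ, hparam.frameMatrix_paramFrame hxΩ]
    simpa using hal.1
  obtain ⟨-, -, hb⟩ := hO ((hmem x hx).1 haV) u v
  have hle : frameCurvature (ψ x) ≤ C := by
    rw [← hsec, huv, div_le_iff₀ (by have := mul_pos (hpos 0) (hpos 1); simpa using this)]
    calc _ ≤ _ := le_abs_self _
      _ ≤ _ := hb
      _ = _ := by ring
  exact absurd hle (not_le.2 haC)

end

section

/-! ### The nilpotent orbit -/

/-- The matrix of `sl(2, ℂ)` with coordinates `z = u + i v` for which `-det` is `z ⬝ᵥ z`. -/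
def orbitMatrix (u v : Su2) : Fin 2 → Fin 2 → ℂ :=
  ![![⟨u 2, v 2⟩, ⟨u 0 + v 1, v 0 - u 1⟩], ![⟨u 0 - v 1, v 0 + u 1⟩, ⟨-u 2, -v 2⟩]]

/-- The real part of the coordinates of a matrix of `sl(2, ℂ)`. -/
def orbitRe (m : Fin 2 → Fin 2 → ℂ) : Su2 :=
  ![((m 0 1).re + (m 1 0).re) / 2, ((m 1 0).im - (m 0 1).im) / 2, (m 0 0).re]

/-- The imaginary part of the coordinates of a matrix of `sl(2, ℂ)`. -/
def orbitIm (m : Fin 2 → Fin 2 → ℂ) : Su2 :=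
  ![((m 0 1).im + (m 1 0).im) / 2, ((m 0 1).re - (m 1 0).re) / 2, (m 0 0).im]

theorem orbitRe_orbitMatrix (u v : Su2) : orbitRe (orbitMatrix u v) = u := by
  ext k; fin_cases k <;> simp [orbitRe, orbitMatrix]

theorem orbitIm_orbitMatrix (u v : Su2) : orbitIm (orbitMatrix u v) = v := by
  ext k; fin_cases k <;> simp [orbitIm, orbitMatrix]

theorem orbitMatrix_trace (u v : Su2) : orbitMatrix u v 0 0 + orbitMatrix u v 1 1 = 0 := by
  simp [orbitMatrix, Complex.ext_iff]

theorem orbitMatrix_orbitRe_orbitIm {m : Fin 2 → Fin 2 → ℂ} (hm : m 0 0 + m 1 1 = 0) :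
    orbitMatrix (orbitRe m) (orbitIm m) = m := by
  rw [Complex.ext_iff] at hm
  simp at hm
  ext i j
  fin_cases i <;> fin_cases j <;>
    simp [orbitRe, orbitIm, orbitMatrix, Complex.ext_iff] <;> constructor <;> linarith

/-- If `x` has eigenvalues `±λ`, then `ad x` has eigenvalues `0, ±2λ`, and `λ² = -det x`. -/
theorem ad_pow_three (x : LieAlgebra.SpecialLinear.sl (Fin 2) ℂ) (hx : x.1 0 0 + x.1 1 1 = 0) :
    LieAlgebra.ad ℂ (LieAlgebra.SpecialLinear.sl (Fin 2) ℂ) x ^ 3 =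
      (4 * (x.1 0 0 ^ 2 + x.1 0 1 * x.1 1 0)) •
        LieAlgebra.ad ℂ (LieAlgebra.SpecialLinear.sl (Fin 2) ℂ) x := by
  have h11 : x.1 1 1 = -x.1 0 0 := by linear_combination hx
  refine LinearMap.ext fun y => Subtype.ext (Matrix.ext fun i j => ?_)
  change (⁅x.1, ⁅x.1, ⁅x.1, y.1⁆⁆⁆ : Matrix (Fin 2) (Fin 2) ℂ) i j =
    ((4 * (x.1 0 0 ^ 2 + x.1 0 1 * x.1 1 0)) • (⁅x.1, y.1⁆ : Matrix (Fin 2) (Fin 2) ℂ)) i j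
  simp only [Ring.lie_def]
  fin_cases i <;> fin_cases j <;>
    simp [Matrix.mul_apply, Fin.sum_univ_two, h11] <;> ring

theorem isNilpotent_ad_iff (x : LieAlgebra.SpecialLinear.sl (Fin 2) ℂ)
    (hx : x.1 0 0 + x.1 1 1 = 0) :
    IsNilpotent (LieAlgebra.ad ℂ (LieAlgebra.SpecialLinear.sl (Fin 2) ℂ) x) ↔
      x.1 0 0 ^ 2 + x.1 0 1 * x.1 1 0 = 0 := by
  have h3 := ad_pow_three x hx
  set A := LieAlgebra.ad ℂ (LieAlgebra.SpecialLinear.sl (Fin 2) ℂ) x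
  constructor
  · rintro ⟨n, hn⟩
    by_contra hd
    set c := 4 * (x.1 0 0 ^ 2 + x.1 0 1 * x.1 1 0)
    have hc : c ≠ 0 := mul_ne_zero (by norm_num) hd
    -- With `c ≠ 0` the odd powers are nonzero multiples of `A`, so nilpotency forces `A = 0`;
    -- commuting with the matrix unit `e` then contradicts `hd`.
    have hpow : ∀ k : ℕ, A ^ (2 * k + 1) = c ^ k • A := by
      intro k
      induction k with
      | zero => simp
      | succ k ih =>
        rw [show 2 * (k + 1) + 1 = (2 * k + 1) + 2 by ring, pow_add, ih, smul_mul_assoc,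
          ← pow_succ', h3, smul_smul, ← pow_succ]
    have hA : A = 0 := by
      have h := hpow n
      rw [show 2 * n + 1 = n + (n + 1) by ring, pow_add, hn, zero_mul] at h
      exact (smul_eq_zero.1 h.symm).resolve_left (pow_ne_zero _ hc)
    let e : LieAlgebra.SpecialLinear.sl (Fin 2) ℂ := ⟨!![0, 1; 0, 0], by
      change Matrix.traceLinearMap (Fin 2) ℂ ℂ _ = 0
      simp [Matrix.trace, Fin.sum_univ_two]⟩
    have he : x.1 * e.1 - e.1 * x.1 = 0 := congrArg Subtype.val (congrArg (fun L => L e) hA)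
    have h00 := congrFun (congrFun he 0) 0
    have h01 := congrFun (congrFun he 0) 1
    simp [e, Matrix.mul_apply, Fin.sum_univ_two, Matrix.vecMul, dotProduct] at h00 h01
    have h0 : x.1 0 0 = 0 := by linear_combination (hx + h01) / 2
    exact hd (by rw [h00, h0]; ring)
  · intro hd
    exact ⟨3, by rw [h3, hd, mul_zero, zero_smul]⟩

theorem mem_nilpotentOrbit_iff {m : Fin 2 → Fin 2 → ℂ} :
    m ∈ nilpotentOrbit ↔ m 0 0 + m 1 1 = 0 ∧ 0 < ip (orbitRe m) (orbitRe m) ∧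
      ip (orbitIm m) (orbitIm m) = ip (orbitRe m) (orbitRe m) ∧
      ip (orbitRe m) (orbitIm m) = 0 := by
  have hsl : Matrix.of m ∈ LieAlgebra.SpecialLinear.sl (Fin 2) ℂ ↔ m 0 0 + m 1 1 = 0 := by
    rw [LieAlgebra.SpecialLinear.sl]
    change Matrix.traceLinearMap (Fin 2) ℂ ℂ (Matrix.of m) = 0 ↔ _
    simp [Matrix.trace, Fin.sum_univ_two]
  have hquad : m 0 0 ^ 2 + m 0 1 * m 1 0 = 0 ↔
      ip (orbitIm m) (orbitIm m) = ip (orbitRe m) (orbitRe m) ∧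
        ip (orbitRe m) (orbitIm m) = 0 := by
    simp only [Complex.ext_iff, ip, dotProduct, Fin.sum_univ_three, orbitRe, orbitIm]
    simp [sq]
    constructor <;> rintro ⟨h1, h2⟩ <;> constructor <;> linarith
  have hzero : m 0 0 + m 1 1 = 0 →
      ip (orbitIm m) (orbitIm m) = ip (orbitRe m) (orbitRe m) →
      (m ≠ 0 ↔ 0 < ip (orbitRe m) (orbitRe m)) := by
    intro ht he
    rw [(ip_self_nonneg _).lt_iff_ne, ← not_iff_not, not_not, not_not]
    constructor
    · rintro rfl
      simp [orbitRe, ip]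
    · intro h
      have hu : orbitRe m = 0 := dotProduct_self_eq_zero.1 h.symm
      have hv : orbitIm m = 0 := dotProduct_self_eq_zero.1 (he.trans h.symm)
      rw [← orbitMatrix_orbitRe_orbitIm ht, hu, hv]
      ext i j
      fin_cases i <;> fin_cases j <;> simp [orbitMatrix, Complex.ext_iff]
  constructor
  · rintro ⟨h0, hm, hn⟩
    have ht := hsl.1 hm
    have hq := hquad.1 ((isNilpotent_ad_iff _ ht).1 hn)
    exact ⟨ht, (hzero ht hq.1).1 h0, hq⟩
  · rintro ⟨ht, hpos, hq⟩
    exact ⟨(hzero ht hq.1).2 hpos, hsl.2 ht, (isNilpotent_ad_iff _ ht).2 (hquad.2 hq)⟩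

/-! ### The diffeomorphism -/

/-- The map from the leaves to the nilpotent orbit. -/
def leafToOrbit (a : Triple) : Fin 2 → Fin 2 → ℂ :=
  orbitMatrix (a 2) (√(ip (a 2) (a 2) / ip (a 1) (a 1)) • a 1)

/-- The map from the nilpotent orbit to a leaf. -/
def orbitToLeaf (q r : ℝ) (m : Fin 2 → Fin 2 → ℂ) : Triple :=
  ![-(√(ip (orbitRe m) (orbitRe m) + q + r) / ip (orbitRe m) (orbitRe m)) •
      br (orbitIm m) (orbitRe m),
    √((ip (orbitRe m) (orbitRe m) + r) / ip (orbitRe m) (orbitRe m)) • orbitIm m,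
    orbitRe m]

variable {q r : ℝ}

theorem mapsTo_leafToOrbit : MapsTo leafToOrbit (leaf q r) nilpotentOrbit := by
  intro a ha
  have h1 := ip_self_pos_of_mem ha 1
  have h2 := ip_self_pos_of_mem ha 2
  rw [mem_nilpotentOrbit_iff, leafToOrbit, orbitRe_orbitMatrix, orbitIm_orbitMatrix,
    ip_smul_left, ip_smul_right, ip_smul_right, ← mul_assoc, Real.mul_self_sqrt (by positivity),
    ha.2.1 2 1 (by decide), div_mul_cancel₀ _ h1.ne']
  exact ⟨orbitMatrix_trace _ _, h2, rfl, mul_zero _⟩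

/-- Since `|v|² = |u|² = s` and `|[v, u]|² = s²`, the coefficients in `orbitToLeaf` give squared
lengths `s + q + r` and `s + r`; the minus sign makes `Φ` negative. -/
theorem mapsTo_orbitToLeaf (hq : 0 ≤ q) (hr : 0 < r) :
    MapsTo (orbitToLeaf q r) nilpotentOrbit (leaf q r) := by
  intro m hm
  obtain ⟨-, hs, hv, huv⟩ := mem_nilpotentOrbit_iff.1 hm
  set u := orbitRe m
  set v := orbitIm m
  have hvu : ip v u = 0 := by rw [ip_comm, huv]
  set s := ip u u
  have hb : ip (br v u) (br v u) = s * s := by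
    rw [ip_br_br, hvu, huv, hv]; ring
  have hsq0 : √(s + q + r) * √(s + q + r) = s + q + r := Real.mul_self_sqrt (by positivity)
  have hsq1 : √((s + r) / s) * √((s + r) / s) = (s + r) / s := Real.mul_self_sqrt (by positivity)
  have e : orbitToLeaf q r m = ![-(√(s + q + r) / s) • br v u, √((s + r) / s) • v, u] := rfl
  rw [mem_leaf_iff, e]
  constructor
  · simp only [Phi, Matrix.cons_val_zero, Matrix.cons_val_one, Matrix.cons_val, br_smul_left,
      ip_smul_left, ip_smul_right, hb]
    have h0 : 0 < √(s + q + r) := Real.sqrt_pos.2 (by positivity)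
    have h1 : 0 < √((s + r) / s) := Real.sqrt_pos.2 (by positivity)
    have : 0 < √(s + q + r) / s * (√((s + r) / s) * (s * s)) := by positivity
    linarith
  · have hc0 : ip (br v u) v = 0 := by rw [ip_comm, ip_br_left]
    have hc1 : ip (br v u) u = 0 := by rw [ip_comm, ip_br_right]
    funext i
    fin_cases i <;>
      simp [leafEquations, ip_smul_left, ip_smul_right, ip_neg_left, ip_neg_right, hc0, hc1, hvu,
        hb, hv]
    · have h0 : √(s + q + r) / s * (√(s + q + r) / s * (s * s)) = s + q + r := by
        field_simp
        rw [sq, hsq0]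
      have h1 : √((s + r) / s) * (√((s + r) / s) * s) = s + r := by
        rw [← mul_assoc, hsq1]; field_simp
      rw [h0, h1]; ring
    · have h1 : √((s + r) / s) * (√((s + r) / s) * s) = s + r := by
        rw [← mul_assoc, hsq1]; field_simp
      rw [h1]; ring

theorem sqrt_div_mul_sqrt_div {x y : ℝ} (hx : 0 < x) (hy : 0 < y) : √(x / y) * √(y / x) = 1 := by
  rw [← Real.sqrt_mul (by positivity), div_mul_div_cancel₀ hy.ne', div_self hx.ne', Real.sqrt_one]

theorem orbitToLeaf_leafToOrbit {a : Triple} (ha : a ∈ leaf q r) :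
    orbitToLeaf q r (leafToOrbit a) = a := by
  have h0 := ip_self_pos_of_mem ha 0
  have h1 := ip_self_pos_of_mem ha 1
  have h2 := ip_self_pos_of_mem ha 2
  have e1 : ip (a 2) (a 2) + r = ip (a 1) (a 1) := by linarith [ha.2.2.2]
  have e0 : ip (a 2) (a 2) + q + r = ip (a 0) (a 0) := by linarith [ha.2.2.1]
  have hP := Phi_sq ha
  have hneg := ha.1
  rw [orbitToLeaf, leafToOrbit, orbitRe_orbitMatrix, orbitIm_orbitMatrix, e1, e0, smul_smul,
    sqrt_div_mul_sqrt_div h1 h2, one_smul, br_smul_left, br_one_two ha, smul_smul, smul_smul]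
  have hc : -(√(ip (a 0) (a 0)) / ip (a 2) (a 2)) * √(ip (a 2) (a 2) / ip (a 1) (a 1)) *
      structureFun a 0 = 1 := by
    rw [structureFun]
    set A := ip (a 0) (a 0)
    set B := ip (a 1) (a 1)
    set C := ip (a 2) (a 2)
    have hA : √A ^ 2 = A := Real.sq_sqrt h0.le
    have hBC : √(C / B) ^ 2 = C / B := Real.sq_sqrt (by positivity)
    -- The factor is nonnegative because `Φ < 0`, and its square is `1` by `Phi_sq`: this is where
    -- the sign of `a 0` is recovered.
    refine (sq_eq_sq₀ ?_ zero_le_one).1 ?_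
    · have : 0 ≤ √A / C * √(C / B) * (-Phi a / A) := by
        have := neg_pos.2 hneg
        positivity
      calc 0 ≤ _ := this
        _ = _ := by ring
    · have : (-(√A / C) * √(C / B) * (Phi a / A)) ^ 2 =
          √A ^ 2 * √(C / B) ^ 2 * Phi a ^ 2 / (C ^ 2 * A ^ 2) := by ring
      rw [this, hA, hBC, hP]
      field_simp
  rw [hc, one_smul]
  funext i
  fin_cases i <;> rfl

theorem leafToOrbit_orbitToLeaf (hr : 0 < r) {m : Fin 2 → Fin 2 → ℂ} (hm : m ∈ nilpotentOrbit) :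
    leafToOrbit (orbitToLeaf q r m) = m := by
  obtain ⟨ht, hs, hv, huv⟩ := mem_nilpotentOrbit_iff.1 hm
  conv_rhs => rw [← orbitMatrix_orbitRe_orbitIm ht]
  set u := orbitRe m with hu
  set v := orbitIm m with hv'
  set s := ip u u
  have hsq1 : √((s + r) / s) * √((s + r) / s) = (s + r) / s := Real.mul_self_sqrt (by positivity)
  have e : orbitToLeaf q r m = ![-(√(s + q + r) / s) • br v u, √((s + r) / s) • v, u] := rfl
  have hN : ip (√((s + r) / s) • v) (√((s + r) / s) • v) = s + r := by
    rw [ip_smul_left, ip_smul_right, hv, ← mul_assoc, hsq1]; field_simp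
  rw [e, leafToOrbit]
  change orbitMatrix u (√(s / ip (√((s + r) / s) • v) (√((s + r) / s) • v)) •
    √((s + r) / s) • v) = _
  rw [hN, smul_smul, sqrt_div_mul_sqrt_div hs (by positivity), one_smul]

theorem contDiff_orbitRe : ContDiff ℝ ∞ orbitRe := by
  have hre : ∀ i j, ContDiff ℝ ∞ fun m : Fin 2 → Fin 2 → ℂ => (m i j).re := fun i j =>
    Complex.reCLM.contDiff.comp (contDiff_apply_apply ℝ ℂ i j)
  have him : ∀ i j, ContDiff ℝ ∞ fun m : Fin 2 → Fin 2 → ℂ => (m i j).im := fun i j =>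
    Complex.imCLM.contDiff.comp (contDiff_apply_apply ℝ ℂ i j)
  rw [contDiff_pi]
  intro k
  fin_cases k
  · exact ((hre 0 1).add (hre 1 0)).div_const 2
  · exact ((him 1 0).sub (him 0 1)).div_const 2
  · exact hre 0 0

theorem contDiff_orbitIm : ContDiff ℝ ∞ orbitIm := by
  have hre : ∀ i j, ContDiff ℝ ∞ fun m : Fin 2 → Fin 2 → ℂ => (m i j).re := fun i j =>
    Complex.reCLM.contDiff.comp (contDiff_apply_apply ℝ ℂ i j)
  have him : ∀ i j, ContDiff ℝ ∞ fun m : Fin 2 → Fin 2 → ℂ => (m i j).im := fun i j =>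
    Complex.imCLM.contDiff.comp (contDiff_apply_apply ℝ ℂ i j)
  rw [contDiff_pi]
  intro k
  fin_cases k
  · exact ((him 0 1).add (him 1 0)).div_const 2
  · exact ((hre 0 1).sub (hre 1 0)).div_const 2
  · exact him 0 0

theorem contDiff_orbitMatrix : ContDiff ℝ ∞ fun p : Su2 × Su2 => orbitMatrix p.1 p.2 := by
  have hmk : ∀ f g : Su2 × Su2 → ℝ, ContDiff ℝ ∞ f → ContDiff ℝ ∞ g →
      ContDiff ℝ ∞ fun p => (⟨f p, g p⟩ : ℂ) := fun f g hf hg =>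
    Complex.equivRealProdCLM.symm.contDiff.comp (hf.prodMk hg)
  rw [contDiff_pi]
  intro i
  rw [contDiff_pi]
  intro j
  fin_cases i <;> fin_cases j <;> exact hmk _ _ (by fun_prop) (by fun_prop)

theorem smoothOnSet_leafToOrbit : SmoothOnSet leafToOrbit (leaf q r) := by
  intro a ha
  have hopen : ∀ k, IsOpen {b : Triple | 0 < ip (b k) (b k)} := fun k =>
    isOpen_Ioi.preimage (contDiff_ip_apply (n := 0) k k).continuous
  refine ⟨{b | 0 < ip (b 1) (b 1)} ∩ {b | 0 < ip (b 2) (b 2)}, leafToOrbit,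
    (hopen 1).inter (hopen 2), ⟨ip_self_pos_of_mem ha 1, ip_self_pos_of_mem ha 2⟩, ?_,
    fun _ _ => rfl⟩
  refine contDiff_orbitMatrix.comp_contDiffOn (ContDiffOn.prodMk (contDiff_apply ..).contDiffOn
    (ContDiffOn.smul (ContDiffOn.sqrt (ContDiffOn.div (contDiff_ip_apply 2 2).contDiffOn
      (contDiff_ip_apply 1 1).contDiffOn fun b hb => ne_of_gt hb.1)
      fun b hb => (div_pos hb.2 hb.1).ne') (contDiff_apply ..).contDiffOn))

theorem contDiff_ip_self : ContDiff ℝ ∞ fun x : Su2 => ip x x := by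
  simp only [ip, dotProduct]
  fun_prop

theorem contDiff_br : ContDiff ℝ ∞ fun p : Su2 × Su2 => br p.1 p.2 := by
  simp only [br, cross_apply]
  rw [contDiff_pi]
  intro k
  fin_cases k <;> simp <;> fun_prop

theorem smoothOnSet_orbitToLeaf (hq : 0 ≤ q) (hr : 0 < r) :
    SmoothOnSet (orbitToLeaf q r) nilpotentOrbit := by
  intro m hm
  have hs : ContDiff ℝ ∞ fun m => ip (orbitRe m) (orbitRe m) :=
    contDiff_ip_self.comp contDiff_orbitRe
  refine ⟨{m | 0 < ip (orbitRe m) (orbitRe m)}, orbitToLeaf q r, isOpen_Ioi.preimage hs.continuous,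
    (mem_nilpotentOrbit_iff.1 hm).2.1, ?_, fun _ _ => rfl⟩
  have hne : ∀ m ∈ {m | 0 < ip (orbitRe m) (orbitRe m)}, ip (orbitRe m) (orbitRe m) ≠ 0 :=
    fun m hm => ne_of_gt hm
  rw [contDiffOn_pi]
  intro k
  fin_cases k
  · refine ContDiffOn.smul (ContDiffOn.neg (ContDiffOn.div (ContDiffOn.sqrt
      ((hs.add contDiff_const).add contDiff_const).contDiffOn fun m hm => ?_) hs.contDiffOn hne))
      (contDiff_br.comp (contDiff_orbitIm.prodMk contDiff_orbitRe)).contDiffOn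
    have h : 0 < ip (orbitRe m) (orbitRe m) := hm
    exact (add_pos (add_pos_of_pos_of_nonneg h hq) hr).ne'
  · refine ContDiffOn.smul (ContDiffOn.sqrt (ContDiffOn.div
      (hs.add contDiff_const).contDiffOn hs.contDiffOn hne) fun m hm => ?_)
      contDiff_orbitIm.contDiffOn
    have h : 0 < ip (orbitRe m) (orbitRe m) := hm
    exact (div_pos (add_pos h hr) h).ne'
  · exact contDiff_orbitRe.contDiffOn

theorem areDiffeomorphic_leaf_nilpotentOrbit (hq : 0 ≤ q) (hr : 0 < r) :
    AreDiffeomorphic (leaf q r) nilpotentOrbit :=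
  ⟨leafToOrbit, orbitToLeaf q r, mapsTo_leafToOrbit, mapsTo_orbitToLeaf hq hr,
    ⟨fun _ ha => orbitToLeaf_leafToOrbit ha, fun _ hm => leafToOrbit_orbitToLeaf hr hm⟩,
    smoothOnSet_leafToOrbit, smoothOnSet_orbitToLeaf hq hr⟩

end

end

end HyperLie

open HyperLie in
/-- Let `N_{q,r}` be a leaf of type 2, i.e. `q ≥ 0` and `r > 0`. At every point `p` of its boundary
the sectional curvature `κ_{q,r}(V₀, V₁)` tends to infinity and the hyperkähler structure does not
extend to `p`; and `N_{q,r}` is diffeomorphic to the nilpotent orbit of `sl(2, ℂ)`. -/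
theorem proposition5p3 (q r : ℝ) (hq : 0 ≤ q) (hr : 0 < r) :
    (∀ p ∈ closure (leaf q r) \ leaf q r,
      Tendsto (fun a => leafSectionalCurvature q r a (frame a 0) (frame a 1))
        (𝓝[leaf q r] p) atTop ∧
      ¬ HyperkahlerExtendsTo q r p) ∧
    AreDiffeomorphic (leaf q r) nilpotentOrbit := by
  refine ⟨fun p hp => ⟨?_, not_hyperkahlerExtendsTo hr hq hp⟩,
    areDiffeomorphic_leaf_nilpotentOrbit hq hr⟩
  refine (tendsto_frameCurvature hr hq hp).congr' ?_
  filter_upwards [self_mem_nhdsWithin] with a ha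
  exact (leafSectionalCurvature_frame ha).symm
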